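/- Let $I\subset\mathbb R$ be open. For $n\ge 1$ let $K_n=\{\tau\in\mathbb R^n:\tau_1<\dots<\tau_n\}$, and for $p\ge 0$, $\tau\in K_{p+2}$, let $$B_p(\tau)(x)=(\tau_{p+2}-\tau_1)\,[\tau_1,\dots,\tau_{p+2}]\,(\bullet-x)_+^p$$ be the B-spline of degree $p$ (divided difference in the variable $\bullet$; $(y)_+^0=1$ for $y>0$ and $0$ otherwise). For $s\ge 0$ let $H^s(I)$ be the Sobolev space of functions whose weak derivatives of order $\le s$ lie in $L^2(I)$, with its usual norm, and $H^s_0(I)$ the closure in it of the smooth functions with compact support in $I$. If $f$ is a continuous linear functional on $H^s(I)$ or $H_0^s(I)$, the duality pairing $f(u)$ is written $\int_I f u\,dx$; for $s=0$, functionals on $L^2(I)$ are identified with functions $f\in L^2(I)$. $\partial_i$ is the partial derivative with respect to the $i$-th knot. (a) Let $p\ge 1$. For every $\tau\in K_{p+2}$, $B_p(\tau)\in H^{p-1}(\mathbb R)$, and for $1\le i\le p+2$ the partial derivative $\partial_iB_p(\tau)\in H^{p-1}(\mathbb R)$ exists in the norm of $H^{p-1}(\mathbb R)$. For every $f$ in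 the dual of $H^{p-1}(I)$, the function $\tau\mapsto\int_I f B_p(\tau)\,dx$ is (Fréchet) differentiable at every $\tau \in K_{p+2}$, and $$\partial_i\int_I f B_p(\tau)\,dx=\int_I f\,\partial_iB_p(\tau)\,dx\qquad(1\le i\le p+2),$$ where $B_p(\tau)$ and $\partial_i B_p(\tau)$ are restricted to $I$ in the pairings. (b) Let $p\ge 1$ and let $f\in H^{-(p-1)}(I)$, the dual of $H^{p-1}_0(I)$. On the set $K_{p+2}(I)$ of all $\tau\in K_{p+2}$ with $(\tau_1,\tau_{p+2})\subset I$, the restrictions to $I$ of $B_p(\tau)$ and $\partial_iB_p(\tau)$ belong to $H^{p-1}_0(I)$, the function $\tau\mapsto\int_I fB_p(\tau)\,dx$ is differentiable within $K_{p+2}(I)$, and the same formula holds, where $\partial_i$ of the integral is taken within $K_{p+2}(I)$ (hence is one-sided where $\tau_i$ can only be moved to one side). (c) Let $p=0$. For every $\tau\in K_2$, $B_0(\tau)\in L^2(\mathbb R)$. Let $f\in H^1(I)$. At every $\tau\in K_2$ none of whose knots lies on the boundary of $I$, the function $\tau\mapsto\int_I f B_0(\tau)\,dx$ is differentiable and $$\partial_i\int_I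 f B_0(\tau)\,dx=\int_I f\,\partial_iB_0(\tau)\,dx\qquad(i=1,2).$$ Here $B_0(\tau)$ is seen as the functional $g\mapsto\int_I gB_0(\tau)\,dx$ on $H^1(I)$, $\partial_iB_0(\tau)$ is its partial derivative in the dual norm, which exists, and the right-hand side is its value at $f$. If $f\in H^1_0(I)$, the same holds at every $\tau\in K_2$, with the partial derivative taken in $H^{-1}(I)$, the dual of $H_0^1(I)$. -/

import Mathlib

open MeasureTheory Set Filter Topology
open scoped ContDiff

noncomputable section

namespace FreeKnot

/-! ### Knot vectors and B-splines -/

/-- Knot vectors with `n` (strictly increasing) knots, an open convex subset of `ℝⁿ`. -/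
def knots (n : ℕ) : Set (Fin n → ℝ) := {τ | StrictMono τ}

/-- The truncated power `y ↦ y₊ ^ p`; for `p = 0` it is the indicator function of `(0, ∞)`. -/
def truncPow (p : ℕ) (y : ℝ) : ℝ := if 0 < y then y ^ p else 0

/-- The divided difference `[τ₁, …, τₙ₊₁] g` at `n + 1` pairwise distinct points. -/
def dividedDiff (g : ℝ → ℝ) : (n : ℕ) → (Fin (n + 1) → ℝ) → ℝ
  | 0, τ => g (τ 0)
  | n + 1, τ =>
      (dividedDiff g n (Fin.tail τ) - dividedDiff g n (Fin.init τ)) / (τ (Fin.last (n + 1)) - τ 0)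

/-- The B-spline functor `B_p(τ)(x) = (τ_{p+2} - τ_1) [τ_1, …, τ_{p+2}] (• - x)₊ ^ p`. -/
def bspline (p : ℕ) (τ : Fin (p + 2) → ℝ) (x : ℝ) : ℝ :=
  (τ (Fin.last (p + 1)) - τ 0) * dividedDiff (fun y => truncPow p (y - x)) (p + 1) τ

/-! ### Sobolev spaces on open subsets of the real line -/

/-- Test functions on `I`: smooth functions with compact support contained in `I`. -/
def IsTest (I : Set ℝ) (φ : ℝ → ℝ) : Prop :=
  ContDiff ℝ ∞ φ ∧ HasCompactSupport φ ∧ tsupport φ ⊆ I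

/-- `v` is the weak derivative of order `k` of `u` on `I`. -/
def IsWeakDeriv (I : Set ℝ) (k : ℕ) (u v : ℝ → ℝ) : Prop :=
  ∀ φ : ℝ → ℝ, IsTest I φ →
    ∫ x in I, u x * iteratedDeriv k φ x = (-1) ^ k * ∫ x in I, v x * φ x

/-- `L²(I)`. -/
abbrev L2 (I : Set ℝ) : Type := Lp ℝ 2 (volume.restrict I)

lemma IsTest.memLp {I J : Set ℝ} {φ : ℝ → ℝ} (h : IsTest I φ) (k : ℕ) :
    MemLp (iteratedDeriv k φ) 2 (volume.restrict J) := by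
  have hc : Continuous (iteratedDeriv k φ) :=
    h.1.continuous_iteratedDeriv k (by exact_mod_cast le_top)
  have hs : HasCompactSupport (iteratedDeriv k φ) := by
    induction k with
    | zero => simpa using h.2.1
    | succ n ih =>
      rw [iteratedDeriv_succ]
      exact (ih (h.1.continuous_iteratedDeriv n (by exact_mod_cast le_top))).deriv
  exact (hc.memLp_of_hasCompactSupport hs).restrict J

lemma IsTest.support_iteratedDeriv_subset {I : Set ℝ} {φ : ℝ → ℝ} (h : IsTest I φ) (k : ℕ) :
    Function.support (iteratedDeriv k φ) ⊆ I := by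
  suffices tsupport (iteratedDeriv k φ) ⊆ tsupport φ from
    (subset_tsupport _).trans (this.trans h.2.2)
  induction k with
  | zero => simp
  | succ n ih =>
    rw [iteratedDeriv_succ]
    exact (closure_minimal support_deriv_subset (isClosed_tsupport _)).trans ih

lemma integrable_mul_test {I J : Set ℝ} {φ : ℝ → ℝ} (h : IsTest I φ) (k : ℕ) (u : L2 J) :
    Integrable (fun x => u x * iteratedDeriv k φ x) (volume.restrict J) :=
  (Lp.memLp u).integrable_mul (h.memLp k)

/-- The Sobolev space `H^s(I)`. The function `u ∈ H^s(I)` is represented by the family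
`(u, Du, …, D^s u)` of its weak derivatives (which `u` determines), in the Hilbert space `L²(I)^{s+1}`.
The inherited norm is the usual one, `‖u‖² = ∑_{k ≤ s} ‖D^k u‖²_{L²(I)}`. -/
def Sob (s : ℕ) (I : Set ℝ) : Submodule ℝ (PiLp 2 fun _ : Fin (s + 1) => L2 I) where
  carrier := {U | ∀ k : Fin (s + 1), IsWeakDeriv I k (U 0) (U k)}
  zero_mem' := by
    intro k φ hφ
    have e : ∀ᵐ x ∂(volume.restrict I), ((0 : L2 I) : ℝ → ℝ) x = 0 := Lp.coeFn_zero _ _ _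
    have h1 : ∫ x in I, ((0 : L2 I) : ℝ → ℝ) x * iteratedDeriv k φ x = 0 := by
      apply integral_eq_zero_of_ae
      filter_upwards [e] with x hx
      rw [hx, zero_mul]
      rfl
    have h2 : ∫ x in I, ((0 : L2 I) : ℝ → ℝ) x * φ x = 0 := by
      apply integral_eq_zero_of_ae
      filter_upwards [e] with x hx
      rw [hx, zero_mul]
      rfl
    simp only [PiLp.zero_apply]
    rw [h1, h2, mul_zero]
  add_mem' := by
    intro U V hU hV k φ hφ
    have key : ∀ (j : Fin (s + 1)) (m : ℕ),
        ∫ x in I, ((U + V) j : L2 I) x * iteratedDeriv m φ x =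
          (∫ x in I, (U j : L2 I) x * iteratedDeriv m φ x) +
            ∫ x in I, (V j : L2 I) x * iteratedDeriv m φ x := by
      intro j m
      rw [← integral_add (integrable_mul_test hφ m _) (integrable_mul_test hφ m _)]
      apply integral_congr_ae
      rw [PiLp.add_apply]
      filter_upwards [Lp.coeFn_add (U j) (V j)] with x hx
      rw [hx, Pi.add_apply, add_mul]
    have k0 := key k 0
    simp only [iteratedDeriv_zero] at k0
    rw [key 0 k, k0, hU k φ hφ, hV k φ hφ, mul_add]
  smul_mem' := by
    intro c U hU k φ hφ
    have key : ∀ (j : Fin (s + 1)) (m : ℕ),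
        ∫ x in I, ((c • U) j : L2 I) x * iteratedDeriv m φ x =
          c * ∫ x in I, (U j : L2 I) x * iteratedDeriv m φ x := by
      intro j m
      rw [← integral_const_mul]
      apply integral_congr_ae
      rw [PiLp.smul_apply]
      filter_upwards [Lp.coeFn_smul c (U j)] with x hx
      rw [hx, Pi.smul_apply, smul_eq_mul, mul_assoc]
    have k0 := key k 0
    simp only [iteratedDeriv_zero] at k0
    rw [key 0 k, k0, hU k φ hφ]
    ring

/-- The function `u` belongs to `H^s(I)`. -/
def MemSob (s : ℕ) (I : Set ℝ) (u : ℝ → ℝ) : Prop :=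
  ∃ U : Sob s I, (U.1 0 : L2 I) =ᵐ[volume.restrict I] u

open Classical in
/-- A function `u` seen as an element of `H^s(I)` (and `0` if it does not belong to `H^s(I)`). -/
def toSob (s : ℕ) (I : Set ℝ) (u : ℝ → ℝ) : Sob s I :=
  if h : MemSob s I u then h.choose else 0

/-- `H_0^s(I)`, the closure of the test functions on `I` in `H^s(I)`. -/
def SobZero (s : ℕ) (I : Set ℝ) : Submodule ℝ (Sob s I) :=
  (Submodule.span ℝ
    {U : Sob s I | ∃ φ, IsTest I φ ∧ (U.1 0 : L2 I) =ᵐ[volume.restrict I] φ}).topologicalClosure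

lemma setIntegral_univ_eq_of_test {I : Set ℝ} {ψ : ℝ → ℝ}
    (hψ : Function.support ψ ⊆ I) (u : ℝ → ℝ) :
    ∫ x in univ, u x * ψ x = ∫ x in I, u x * ψ x := by
  rw [setIntegral_eq_of_subset_of_forall_sdiff_eq_zero MeasurableSet.univ (subset_univ I)]
  intro x hx
  have : ψ x = 0 := by
    by_contra h
    exact hx.2 (hψ h)
  rw [this, mul_zero]

/-- The restriction `H^s(ℝ) → H^s(I)`. -/
def restr (s : ℕ) (I : Set ℝ) (U : Sob s univ) : Sob s I :=
  ⟨WithLp.toLp 2 fun k =>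
      ((Lp.memLp (U.1 k : L2 univ)).mono_measure
        (Measure.restrict_mono (subset_univ I) le_rfl)).toLp _, by
    intro k φ hφ
    have e : ∀ (j : Fin (s + 1)) (m : ℕ),
        ∫ x in I, ((((Lp.memLp (U.1 j : L2 univ)).mono_measure
          (Measure.restrict_mono (subset_univ I) le_rfl)).toLp _ : L2 I) : ℝ → ℝ) x
            * iteratedDeriv m φ x = ∫ x in univ, (U.1 j : L2 univ) x * iteratedDeriv m φ x := by
      intro j m
      rw [setIntegral_univ_eq_of_test (hφ.support_iteratedDeriv_subset m)]
      apply integral_congr_ae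
      filter_upwards [MemLp.coeFn_toLp ((Lp.memLp (U.1 j : L2 univ)).mono_measure
          (Measure.restrict_mono (subset_univ I) le_rfl))] with x hx
      rw [hx]
    have e0 := e k 0
    simp only [iteratedDeriv_zero] at e0
    have h := U.2 k φ ⟨hφ.1, hφ.2.1, subset_univ _⟩
    refine (e 0 k).trans (h.trans ?_)
    rw [← e0]⟩

open Classical in
/-- `L²` functions seen as elements of `L²(I)` (and `0` for other functions). -/
def toL2 (I : Set ℝ) (u : ℝ → ℝ) : L2 I :=
  if h : MemLp u 2 (volume.restrict I) then h.toLp u else 0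

/-- `u ∈ L²(I)` seen as the element `g ↦ ∫_I u g` of the normed dual space of `H¹(I)`. -/
def dualSob (I : Set ℝ) (u : ℝ → ℝ) : Sob 1 I →L[ℝ] ℝ :=
  (innerSL ℝ (toL2 I u)).comp
    ((PiLp.proj 2 (fun _ : Fin (1 + 1) => L2 I) 0).comp (Sob 1 I).subtypeL)

lemma dualSob_apply (I : Set ℝ) {u : ℝ → ℝ} (hu : MemLp u 2 (volume.restrict I)) (g : Sob 1 I) :
    dualSob I u g = ∫ x in I, (g.1 0 : L2 I) x * u x := by
  have : dualSob I u g = inner ℝ (toL2 I u) (g.1 0 : L2 I) := rfl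
  rw [this, toL2, dif_pos hu, L2.inner_def]
  apply integral_congr_ae
  filter_upwards [hu.coeFn_toLp] with x hx
  rw [hx]
  simp

/-- `u ∈ L²(I)` seen as the element `g ↦ ∫_I u g` of `H^{-1}(I)`, the normed dual space of
`H_0^1(I)`. -/
def dualSobZero (I : Set ℝ) (u : ℝ → ℝ) : SobZero 1 I →L[ℝ] ℝ :=
  (dualSob I u).comp (SobZero 1 I).subtypeL

/-! ### B-splines as maps into Sobolev spaces -/

/-- `B_p(τ)` as an element of `H^{p-1}(ℝ)`, for `p ≥ 1`. -/
def bsplineSob (p : ℕ) (τ : Fin (p + 2) → ℝ) : Sob (p - 1) univ :=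
  toSob (p - 1) univ (bspline p τ)

/-- `∂_i B_p(τ) ∈ H^{p-1}(ℝ)`, for `p ≥ 1`: the derivative of `B_p` with respect to the `i`-th knot,
in the norm of `H^{p-1}(ℝ)`. -/
def partialBspline (p : ℕ) (i : Fin (p + 2)) (τ : Fin (p + 2) → ℝ) : Sob (p - 1) univ :=
  deriv (fun t : ℝ => bsplineSob p (Function.update τ i t)) (τ i)

/-- The pairing `∫_I f u` of `f ∈ H^{-s}(I) = H_0^s(I)'` and `u ∈ H_0^s(I)` (and `0` if
`u ∈ H^s(I)` does not belong to `H_0^s(I)`). -/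
def pairZero {s : ℕ} {I : Set ℝ} (f : SobZero s I →L[ℝ] ℝ) (u : Sob s I) : ℝ :=
  open Classical in if h : u ∈ SobZero s I then f ⟨u, h⟩ else 0

/-- Knot vectors whose B-spline is supported in the closure of `I`, in the sense that
`(τ_1, τ_{p+2}) ⊆ I`. -/
def knotsIn (p : ℕ) (I : Set ℝ) : Set (Fin (p + 2) → ℝ) :=
  {τ | τ ∈ knots (p + 2) ∧ Ioo (τ 0) (τ (Fin.last (p + 1))) ⊆ I}

/-- `∂_i B_0(τ)` as an element of the dual of `H¹(I)`: the derivative of `B_0` with respect to the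
`i`-th knot, in the dual norm. -/
def partialDual (I : Set ℝ) (i : Fin 2) (τ : Fin 2 → ℝ) : Sob 1 I →L[ℝ] ℝ :=
  deriv (fun t : ℝ => dualSob I (bspline 0 (Function.update τ i t))) (τ i)

/-- `∂_i B_0(τ)` as an element of `H^{-1}(I) = H_0^1(I)'`: the derivative of `B_0` with respect to
the `i`-th knot, in the dual norm. -/
def partialDualZero (I : Set ℝ) (i : Fin 2) (τ : Fin 2 → ℝ) : SobZero 1 I →L[ℝ] ℝ :=
  deriv (fun t : ℝ => dualSobZero I (bspline 0 (Function.update τ i t))) (τ i)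

end FreeKnot

end

namespace FreeKnot

/-! ### Divided differences -/

/-! A divided difference is a sum of point values whose weights depend differentiably on strictly
increasing knots (`differentiableAt_ddWeight`). For `p ≥ 1` the derivatives of `B_p(τ)` of order at
most `p - 1` are therefore combinations of truncated powers `(τ_j - x)₊ ^ q` with `q ≥ 1`. Such a
power, cut off to `[-R, R]`, is a differentiable function of its knot with values in `L²`: its
difference quotients are dominated and converge off a null set (`differentiable_truncL2`). The
cutoff changes nothing, because B-splines vanish outside the interval spanned by their knots
(`spline_eq_zero`). So `B_p` is Fréchet differentiable into `H^{p-1}(ℝ)`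
(`differentiableAt_bsplineSob`), and continuous linear maps, namely restriction and `f`, preserve
this.

For `H_0^{p-1}(I)`, a spline with closed support interval inside `I` is a limit of mollifications
(`mem_SobZero_of_hasDerivAt`). If only the open interval lies in `I`, the knots are contracted
towards their midpoint. The partial derivatives are limits of one-sided difference quotients in the
closed subspace. Orthogonal projection extends `f` to `H^{p-1}(I)`.

For `p = 0` the spline is a step function, and the two knots separate by additivity. A knot outside
the closure of `I` contributes a locally constant functional. At a knot inside `I`, integration by
parts (`integral_mul_step`) moves the step onto its primitive, made of truncated powers of exponent
one, at the cost of a smooth cutoff. This exhibits a differentiable family of functionals on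
`H¹(I)`. For `H_0^1(I)`, extension by zero (`dualSobZero_eq`) reduces to the whole line, which has
no boundary. -/

/-- The coefficient of `g (τ j)` in the divided difference `[τ₁, …, τₙ₊₁] g`. -/
noncomputable def ddWeight : (n : ℕ) → (Fin (n + 1) → ℝ) → Fin (n + 1) → ℝ
  | 0, _ => fun _ => 1
  | n + 1, τ => fun j =>
      ((Fin.cons 0 (ddWeight n (Fin.tail τ)) : Fin (n + 2) → ℝ) j -
        (Fin.snoc (ddWeight n (Fin.init τ)) 0 : Fin (n + 2) → ℝ) j) /
          (τ (Fin.last (n + 1)) - τ 0)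

lemma dividedDiff_eq_sum (g : ℝ → ℝ) (n : ℕ) (τ : Fin (n + 1) → ℝ) :
    dividedDiff g n τ = ∑ j, ddWeight n τ j * g (τ j) := by
  induction n with
  | zero => simp [dividedDiff, ddWeight]
  | succ n ih =>
    have h1 : ∑ j, (Fin.cons 0 (ddWeight n (Fin.tail τ)) : Fin (n + 2) → ℝ) j * g (τ j) =
        dividedDiff g n (Fin.tail τ) := by
      rw [ih, Fin.sum_univ_succ]
      simp [Fin.tail]
    have h2 : ∑ j, (Fin.snoc (ddWeight n (Fin.init τ)) 0 : Fin (n + 2) → ℝ) j * g (τ j) =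
        dividedDiff g n (Fin.init τ) := by
      rw [ih, Fin.sum_univ_castSucc]
      simp [Fin.init]
    simp only [dividedDiff, ddWeight, ← h1, ← h2, ← Finset.sum_sub_distrib, Finset.sum_div]
    exact Finset.sum_congr rfl fun j _ => by ring

lemma tail_mem_knots {n : ℕ} {τ : Fin (n + 1) → ℝ} (h : τ ∈ knots (n + 1)) :
    Fin.tail τ ∈ knots n :=
  fun _ _ hij => h (Fin.succ_lt_succ_iff.2 hij)

lemma init_mem_knots {n : ℕ} {τ : Fin (n + 1) → ℝ} (h : τ ∈ knots (n + 1)) :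
    Fin.init τ ∈ knots n :=
  fun _ _ hij => h (Fin.castSucc_lt_castSucc_iff.2 hij)

lemma zero_lt_last_of_mem_knots {n : ℕ} {τ : Fin (n + 2) → ℝ} (h : τ ∈ knots (n + 2)) :
    τ 0 < τ (Fin.last (n + 1)) :=
  h (Fin.last_pos)

/-- The recursion divides only by the difference of the last and first knot, which is positive for
increasing knots and all their sub-vectors. -/
lemma differentiableAt_ddWeight (n : ℕ) {τ : Fin (n + 1) → ℝ} (h : τ ∈ knots (n + 1))
    (j : Fin (n + 1)) : DifferentiableAt ℝ (fun σ => ddWeight n σ j) τ := by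
  induction n with
  | zero => exact differentiableAt_const _
  | succ n ih =>
    have ht : DifferentiableAt ℝ (fun σ : Fin (n + 2) → ℝ => (Fin.tail σ : Fin (n + 1) → ℝ)) τ :=
      differentiableAt_pi.2 fun i => differentiableAt_apply i.succ τ
    have hi : DifferentiableAt ℝ (fun σ : Fin (n + 2) → ℝ => (Fin.init σ : Fin (n + 1) → ℝ)) τ :=
      differentiableAt_pi.2 fun i => differentiableAt_apply i.castSucc τ
    have h1 : DifferentiableAt ℝ (fun σ : Fin (n + 2) → ℝ =>
        (Fin.cons 0 (ddWeight n (Fin.tail σ)) : Fin (n + 2) → ℝ) j) τ := by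
      refine Fin.cases ?_ (fun i => ?_) j
      · simp
      · simp only [Fin.cons_succ]
        exact DifferentiableAt.comp (g := fun σ => ddWeight n σ i) τ (ih (tail_mem_knots h) i) ht
    have h2 : DifferentiableAt ℝ (fun σ : Fin (n + 2) → ℝ =>
        (Fin.snoc (ddWeight n (Fin.init σ)) 0 : Fin (n + 2) → ℝ) j) τ := by
      refine Fin.lastCases ?_ (fun i => ?_) j
      · simp
      · simp only [Fin.snoc_castSucc]
        exact DifferentiableAt.comp (g := fun σ => ddWeight n σ i) τ (ih (init_mem_knots h) i) hi
    simp only [ddWeight]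
    have h3 : DifferentiableAt ℝ (fun σ : Fin (n + 2) → ℝ => σ (Fin.last (n + 1)) - σ 0) τ := by
      fun_prop
    exact (h1.fun_sub h2).fun_mul (h3.fun_inv (sub_pos.2 (zero_lt_last_of_mem_knots h)).ne')

lemma dividedDiff_congr {f g : ℝ → ℝ} {n : ℕ} {τ : Fin (n + 1) → ℝ}
    (h : ∀ j, f (τ j) = g (τ j)) : dividedDiff f n τ = dividedDiff g n τ := by
  simp only [dividedDiff_eq_sum, h]

lemma dividedDiff_add (f g : ℝ → ℝ) (n : ℕ) (τ : Fin (n + 1) → ℝ) :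
    dividedDiff (fun y => f y + g y) n τ = dividedDiff f n τ + dividedDiff g n τ := by
  simp only [dividedDiff_eq_sum, mul_add, Finset.sum_add_distrib]

lemma dividedDiff_const_mul (c : ℝ) (g : ℝ → ℝ) (n : ℕ) (τ : Fin (n + 1) → ℝ) :
    dividedDiff (fun y => c * g y) n τ = c * dividedDiff g n τ := by
  simp only [dividedDiff_eq_sum, Finset.mul_sum]
  exact Finset.sum_congr rfl fun j _ => by ring

/-- The Leibniz rule for the product with a linear factor vanishing at the first point. -/
lemma dividedDiff_sub_mul (g : ℝ → ℝ) (n : ℕ) {τ : Fin (n + 2) → ℝ} (h : τ ∈ knots (n + 2)) :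
    dividedDiff (fun y => (y - τ 0) * g y) (n + 1) τ = dividedDiff g n (Fin.tail τ) := by
  induction n with
  | zero =>
    have h0 := zero_lt_last_of_mem_knots h
    have h1 : τ 1 - τ 0 ≠ 0 := (sub_pos.2 h0).ne'
    simp [dividedDiff, Fin.tail, Fin.init]
    field_simp
  | succ n ih =>
    have h0 := zero_lt_last_of_mem_knots h
    have h2 := zero_lt_last_of_mem_knots (tail_mem_knots h)
    have hA : dividedDiff (fun y => (y - τ 0) * g y) (n + 1) (Fin.init τ) =
        dividedDiff g n (Fin.init (Fin.tail τ)) := by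
      rw [← Fin.tail_init_eq_init_tail]
      exact ih (init_mem_knots h)
    -- The tail starts at the second knot, so the linear factor is split as `(y - τ 1) + (τ 1 - τ
    -- 0)` to fit the induction hypothesis.
    have hB : dividedDiff (fun y => (y - τ 0) * g y) (n + 1) (Fin.tail τ) =
        dividedDiff g n (Fin.tail (Fin.tail τ)) +
          (Fin.tail τ 0 - τ 0) * dividedDiff g (n + 1) (Fin.tail τ) := by
      rw [← ih (tail_mem_knots h), ← dividedDiff_const_mul, ← dividedDiff_add]
      exact dividedDiff_congr fun j => by ring
    have hl : Fin.tail τ (Fin.last (n + 1)) = τ (Fin.last (n + 2)) := rfl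
    have hC : dividedDiff g (n + 1) (Fin.tail τ) =
      (dividedDiff g n (Fin.tail (Fin.tail τ)) - dividedDiff g n (Fin.init (Fin.tail τ))) /
        (τ (Fin.last (n + 2)) - Fin.tail τ 0) := rfl
    rw [hl] at h2
    rw [dividedDiff, hA, hB, hC]
    have e1 := (sub_pos.2 h0).ne'
    have e2 := (sub_pos.2 h2).ne'
    field_simp
    ring

lemma dividedDiff_one (n : ℕ) (τ : Fin (n + 2) → ℝ) :
    dividedDiff (fun _ => 1) (n + 1) τ = 0 := by
  induction n with
  | zero => simp [dividedDiff]
  | succ n ih => rw [dividedDiff, ih, ih]; simp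

/-- Divided differences of order `n` annihilate polynomials of degree less than `n`. -/
lemma dividedDiff_sub_pow_eq_zero (x : ℝ) (q n : ℕ) (hq : q < n) {τ : Fin (n + 1) → ℝ}
    (h : τ ∈ knots (n + 1)) : dividedDiff (fun y => (y - x) ^ q) n τ = 0 := by
  induction q generalizing n with
  | zero =>
    obtain ⟨n, rfl⟩ := Nat.exists_eq_succ_of_ne_zero (Nat.pos_iff_ne_zero.1 hq)
    simpa using dividedDiff_one n τ
  | succ q ih =>
    obtain ⟨n, rfl⟩ := Nat.exists_eq_succ_of_ne_zero (Nat.ne_zero_of_lt hq)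
    -- One factor `y - x` is split as `(y - τ 0) + (τ 0 - x)`: the first term lowers degree and
    -- order together, the second only the degree.
    have e : dividedDiff (fun y => (y - x) ^ (q + 1)) (n + 1) τ =
        dividedDiff (fun y => (y - τ 0) * (y - x) ^ q) (n + 1) τ +
          (τ 0 - x) * dividedDiff (fun y => (y - x) ^ q) (n + 1) τ := by
      rw [← dividedDiff_const_mul, ← dividedDiff_add]
      exact dividedDiff_congr fun j => by ring
    rw [e, dividedDiff_sub_mul _ n h, ih n (by omega) (tail_mem_knots h),
      ih (n + 1) (by omega) h, mul_zero, add_zero]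

/-! ### Truncated powers and splines -/

lemma truncPow_succ (q : ℕ) (y : ℝ) : truncPow (q + 1) y = max y 0 ^ (q + 1) := by
  unfold truncPow
  split_ifs with h
  · rw [max_eq_left h.le]
  · rw [max_eq_right (not_lt.1 h)]; simp

lemma continuous_truncPow {q : ℕ} (hq : 1 ≤ q) : Continuous (truncPow q) := by
  obtain ⟨q, rfl⟩ := Nat.exists_eq_add_of_le' hq
  have : truncPow (q + 1) = fun y => max y 0 ^ (q + 1) := funext (truncPow_succ q)
  rw [this]
  fun_prop

lemma measurable_truncPow (q : ℕ) : Measurable (truncPow q) :=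
  Measurable.ite measurableSet_Ioi (by fun_prop) measurable_const

lemma hasDerivAt_truncPow_of_ne (q : ℕ) {y : ℝ} (hy : y ≠ 0) :
    HasDerivAt (truncPow (q + 1)) ((q + 1) * truncPow q y) y := by
  rcases hy.lt_or_gt with h | h
  · have : truncPow q y = 0 := if_neg h.not_gt
    rw [this, mul_zero]
    refine (hasDerivAt_const y (0 : ℝ)).congr_of_eventuallyEq ?_
    filter_upwards [Iio_mem_nhds h] with z hz
    exact if_neg (not_lt.2 (le_of_lt hz))
  · have : truncPow q y = y ^ q := if_pos h
    rw [this]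
    have := hasDerivAt_pow (q + 1) y
    simp only [Nat.add_sub_cancel, Nat.cast_add, Nat.cast_one] at this
    refine this.congr_of_eventuallyEq ?_
    filter_upwards [Ioi_mem_nhds h] with z hz
    exact if_pos hz

/-- At the kink the candidate derivative is still continuous because `1 ≤ q`, so differentiability
extends across it. -/
lemma hasDerivAt_truncPow (q : ℕ) (hq : 1 ≤ q) (y : ℝ) :
    HasDerivAt (truncPow (q + 1)) ((q + 1) * truncPow q y) y := by
  rcases ne_or_eq y 0 with hy | rfl
  · exact hasDerivAt_truncPow_of_ne q hy
  · exact hasDerivAt_of_hasDerivAt_of_ne (fun y hy => hasDerivAt_truncPow_of_ne q hy)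
      (continuous_truncPow (by omega)).continuousAt
      ((continuous_truncPow hq).continuousAt.const_mul _)

/-- The spline obtained from the definition of `bspline p` on taking truncated powers of
exponent `q`. Up to constant factors these are the derivatives of `bspline p`. -/
noncomputable def spline (p q : ℕ) (τ : Fin (p + 2) → ℝ) (x : ℝ) : ℝ :=
  (τ (Fin.last (p + 1)) - τ 0) * dividedDiff (fun y => truncPow q (y - x)) (p + 1) τ

lemma spline_eq_sum (p q : ℕ) (τ : Fin (p + 2) → ℝ) (x : ℝ) :
    spline p q τ x = (τ (Fin.last (p + 1)) - τ 0) *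
      ∑ j, ddWeight (p + 1) τ j * truncPow q (τ j - x) := by
  rw [spline, dividedDiff_eq_sum]

lemma continuous_spline {p q : ℕ} (hq : 1 ≤ q) (τ : Fin (p + 2) → ℝ) :
    Continuous (spline p q τ) := by
  have : spline p q τ = _ := funext (spline_eq_sum p q τ)
  rw [this]
  have h := continuous_truncPow hq
  refine continuous_const.mul (continuous_finsetSum _ fun j _ => continuous_const.mul ?_)
  exact h.comp (by fun_prop)

lemma hasDerivAt_spline {p q : ℕ} (hq : 1 ≤ q) (τ : Fin (p + 2) → ℝ) (x : ℝ) :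
    HasDerivAt (spline p (q + 1) τ) (-(q + 1) * spline p q τ x) x := by
  have : spline p (q + 1) τ = _ := funext (spline_eq_sum p (q + 1) τ)
  rw [this, spline_eq_sum]
  have h : ∀ j, HasDerivAt (fun x => ddWeight (p + 1) τ j * truncPow (q + 1) (τ j - x))
      (ddWeight (p + 1) τ j * ((q + 1) * truncPow q (τ j - x) * -1)) x := fun j =>
    ((hasDerivAt_truncPow q hq (τ j - x)).comp x
      ((hasDerivAt_id x).const_sub (τ j))).const_mul _
  refine ((HasDerivAt.fun_sum fun j (_ : j ∈ Finset.univ) => h j).const_mul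
    (τ (Fin.last (p + 1)) - τ 0)).congr_deriv ?_
  simp only [Finset.mul_sum]
  exact Finset.sum_congr rfl fun j _ => by ring

/-- To the left of all knots the truncated powers are polynomials of degree at most `p`, annihilated
by a divided difference of order `p + 1`; to the right each term vanishes. -/
lemma spline_eq_zero {p q : ℕ} (hq : q ≤ p) {τ : Fin (p + 2) → ℝ} (hτ : τ ∈ knots (p + 2))
    {x : ℝ} (hx : x ∉ Icc (τ 0) (τ (Fin.last (p + 1)))) : spline p q τ x = 0 := by
  rcases lt_or_ge x (τ 0) with h | h
  · rw [spline, dividedDiff_congr (g := fun y => (y - x) ^ q),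
      dividedDiff_sub_pow_eq_zero x q (p + 1) (by omega) hτ, mul_zero]
    intro j
    exact if_pos (sub_pos.2 (h.trans_le (hτ.monotone (Fin.zero_le j))))
  · have h2 : τ (Fin.last (p + 1)) < x := not_le.1 fun h' => hx ⟨h, h'⟩
    rw [spline_eq_sum, Finset.sum_eq_zero, mul_zero]
    intro j _
    have : τ j ≤ τ (Fin.last (p + 1)) := hτ.monotone (Fin.le_last j)
    rw [truncPow, if_neg (by linarith), mul_zero]

lemma isOpen_knots (n : ℕ) : IsOpen (knots n) := by
  have : knots n = ⋂ i, ⋂ j, {τ : Fin n → ℝ | i < j → τ i < τ j} := by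
    ext τ
    simp only [knots, mem_ofPred_eq, mem_iInter]
    exact ⟨fun h i j hij => h hij, fun h i j hij => h i j hij⟩
  rw [this]
  refine isOpen_iInter_of_finite fun i => isOpen_iInter_of_finite fun j => ?_
  by_cases hij : i < j
  · simp only [hij, forall_const]
    exact isOpen_lt (continuous_apply i) (continuous_apply j)
  · simp [hij]

/-! ### Convergence and differentiability in `L²` -/

section L2

variable {α : Type*} [MeasurableSpace α] {μ : Measure α}

lemma norm_sub_sq_eq_integral {u v : Lp ℝ 2 μ} {f g : α → ℝ} (hu : u =ᵐ[μ] f) (hv : v =ᵐ[μ] g) :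
    ‖u - v‖ ^ 2 = ∫ x, (f x - g x) ^ 2 ∂μ := by
  rw [← real_inner_self_eq_norm_sq, L2.inner_def]
  refine integral_congr_ae ?_
  filter_upwards [Lp.coeFn_sub u v, hu, hv] with x h1 h2 h3
  rw [h1, Pi.sub_apply, h2, h3]
  simp [pow_two]

/-- Dominated convergence in `L²`. -/
lemma tendsto_Lp_of_dominated {ι : Type*} {l : Filter ι} [l.IsCountablyGenerated]
    {F : ι → Lp ℝ 2 μ} {f : Lp ℝ 2 μ} {G : ι → α → ℝ} {g b : α → ℝ}
    (hG : ∀ i, F i =ᵐ[μ] G i) (hg : f =ᵐ[μ] g) (hb : MemLp b 2 μ)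
    (h1 : ∀ᶠ i in l, ∀ᵐ x ∂μ, |G i x - g x| ≤ b x)
    (h2 : ∀ᵐ x ∂μ, Tendsto (fun i => G i x) l (𝓝 (g x))) : Tendsto F l (𝓝 f) := by
  rw [tendsto_iff_norm_sub_tendsto_zero]
  have key : Tendsto (fun i => ‖F i - f‖ ^ 2) l (𝓝 0) := by
    simp_rw [fun i => norm_sub_sq_eq_integral (hG i) hg]
    rw [← integral_zero α ℝ (μ := μ)]
    refine tendsto_integral_filter_of_dominated_convergence (fun x => b x ^ 2) ?_ ?_
      hb.integrable_sq ?_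
    · refine Eventually.of_forall fun i => ?_
      have hi : AEStronglyMeasurable (G i) μ := (Lp.aestronglyMeasurable (F i)).congr (hG i)
      have hj : AEStronglyMeasurable g μ := (Lp.aestronglyMeasurable f).congr hg
      exact (hi.sub hj).pow 2
    · filter_upwards [h1] with i hi
      filter_upwards [hi] with x hx
      rw [Real.norm_eq_abs, abs_pow]
      gcongr
    · filter_upwards [h2] with x hx
      simpa using (hx.sub_const (g x)).pow 2
  have := key.sqrt
  simpa [Real.sqrt_sq (norm_nonneg _)] using this

/-- A dominated pointwise derivative is a derivative in `L²`. -/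
lemma hasDerivAt_Lp_of_dominated {F : ℝ → Lp ℝ 2 μ} {F' : Lp ℝ 2 μ} {G : ℝ → α → ℝ}
    {G' b : α → ℝ} {t : ℝ} (hG : ∀ r, F r =ᵐ[μ] G r) (hG' : F' =ᵐ[μ] G') (hb : MemLp b 2 μ)
    (h1 : ∀ᶠ r in 𝓝 t, ∀ᵐ x ∂μ, |G r x - G t x| ≤ b x * |r - t|)
    (h2 : ∀ᵐ x ∂μ, HasDerivAt (fun r => G r x) (G' x) t) : HasDerivAt F F' t := by
  rw [hasDerivAt_iff_tendsto_slope]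
  have hs : ∀ r, (slope F t r : Lp ℝ 2 μ) =ᵐ[μ] fun x => slope (fun r => G r x) t r := by
    intro r
    rw [slope_def_module]
    filter_upwards [Lp.coeFn_smul (r - t)⁻¹ (F r - F t), Lp.coeFn_sub (F r) (F t), hG r, hG t]
      with x e1 e2 e3 e4
    rw [slope_def_module, e1, Pi.smul_apply, e2, Pi.sub_apply, e3, e4]
  have hG'm : MemLp G' 2 μ := (memLp_congr_ae hG').1 (Lp.memLp F')
  -- The bound must control slope minus limit: `b` dominates the slope, and the norm of `G'`
  -- accounts for the limit.
  refine tendsto_Lp_of_dominated hs hG' (hb.add hG'm.norm) ?_ ?_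
  · filter_upwards [h1.filter_mono nhdsWithin_le_nhds, self_mem_nhdsWithin] with r hr hne
    filter_upwards [hr] with x hx
    have h0 : 0 < |r - t| := abs_pos.2 (sub_ne_zero.2 hne)
    rw [Pi.add_apply]
    refine (abs_sub _ _).trans (add_le_add ?_ le_rfl)
    rw [slope_def_field, abs_div, div_le_iff₀ h0]
    exact hx
  · filter_upwards [h2] with x hx
    exact hx.tendsto_slope

end L2

lemma integral_mul_eq_inner {α : Type*} [MeasurableSpace α] {μ : Measure α} {f : α → ℝ}
    (hf : MemLp f 2 μ) (u : Lp ℝ 2 μ) : ∫ x, u x * f x ∂μ = inner ℝ (hf.toLp f) u := by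
  rw [L2.inner_def]
  refine integral_congr_ae ?_
  filter_upwards [hf.coeFn_toLp] with x hx
  simp [hx]

/-- Maps into a complemented closed subspace are differentiable if they are so in the
surrounding space. -/
lemma differentiableAt_submodule {E H : Type*} [NormedAddCommGroup E] [NormedSpace ℝ E]
    [NormedAddCommGroup H] [InnerProductSpace ℝ H] {K : Submodule ℝ H} [K.HasOrthogonalProjection]
    {F : E → K} {x : E} (h : DifferentiableAt ℝ (fun y => (F y : H)) x) :
    DifferentiableAt ℝ F x := by
  -- The projection is a continuous linear left inverse of the inclusion.
  have := (K.orthogonalProjectionOnto.differentiableAt (x := (F x : H))).comp x h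
  refine this.congr_of_eventuallyEq (Eventually.of_forall fun y => ?_)
  exact (Submodule.orthogonalProjectionOnto_mem_subspace_eq_self (F y)).symm

/-! ### Sobolev spaces -/

/-- Each weak derivative identity, for one test function, equates two continuous functions of `U`,
since both sides are inner products. The resulting completeness supplies the orthogonal projections
used later. -/
lemma isClosed_Sob (s : ℕ) (I : Set ℝ) :
    IsClosed (Sob s I : Set (PiLp 2 fun _ : Fin (s + 1) => L2 I)) := by
  have : (Sob s I : Set (PiLp 2 fun _ : Fin (s + 1) => L2 I)) =
      ⋂ k : Fin (s + 1), ⋂ φ : {φ : ℝ → ℝ // IsTest I φ},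
        {U | inner ℝ ((φ.2.memLp k).toLp (iteratedDeriv k φ.1)) (U 0 : L2 I) =
          (-1) ^ (k : ℕ) * inner ℝ ((φ.2.memLp 0).toLp (iteratedDeriv 0 φ.1)) (U k : L2 I)} := by
    ext U
    simp only [mem_iInter, Subtype.forall, mem_ofPred_eq, ← integral_mul_eq_inner,
      iteratedDeriv_zero]
    rfl
  rw [this]
  refine isClosed_iInter fun k => isClosed_iInter fun φ => isClosed_eq ?_ ?_
  · exact continuous_const.inner (PiLp.continuous_apply 2 _ _)
  · exact continuous_const.mul (continuous_const.inner (PiLp.continuous_apply 2 _ _))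

instance (s : ℕ) (I : Set ℝ) : CompleteSpace (Sob s I) :=
  (isClosed_Sob s I).completeSpace_coe

instance (s : ℕ) (I : Set ℝ) : CompleteSpace (SobZero s I) :=
  (Submodule.isClosed_topologicalClosure _).completeSpace_coe

lemma IsWeakDeriv.congr_ae {I : Set ℝ} {k : ℕ} {u v u' v' : ℝ → ℝ} (h : IsWeakDeriv I k u v)
    (hu : u =ᵐ[volume.restrict I] u') (hv : v =ᵐ[volume.restrict I] v') :
    IsWeakDeriv I k u' v' := by
  intro φ hφ
  have h1 : ∫ x in I, u' x * iteratedDeriv k φ x = ∫ x in I, u x * iteratedDeriv k φ x :=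
    integral_congr_ae (by filter_upwards [hu] with x hx; rw [hx])
  have h2 : ∫ x in I, v' x * φ x = ∫ x in I, v x * φ x :=
    integral_congr_ae (by filter_upwards [hv] with x hx; rw [hx])
  rw [h1, h2, h φ hφ]

/-- Weak derivatives are unique. -/
lemma IsWeakDeriv.unique {I : Set ℝ} (hI : IsOpen I) {k : ℕ} {u : ℝ → ℝ} {v w : L2 I}
    (hv : IsWeakDeriv I k u v) (hw : IsWeakDeriv I k u w) : v = w := by
  rw [← sub_eq_zero]
  refine Lp.ext ?_
  have hloc : LocallyIntegrableOn (v - w : L2 I) I (volume.restrict I) :=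
    ((Lp.memLp (v - w)).locallyIntegrable one_le_two).locallyIntegrableOn I
  have key := hI.ae_eq_zero_of_integral_contDiff_smul_eq_zero hloc ?_
  · filter_upwards [key, ae_restrict_mem hI.measurableSet,
      Lp.coeFn_zero ℝ 2 (volume.restrict I)] with x h1 h2 h3
    rw [h1 h2, h3]
    rfl
  · intro φ h1 h2 h3
    have hφ : IsTest I φ := ⟨h1, h2, h3⟩
    have e : ∫ x in I, v x * φ x = ∫ x in I, w x * φ x :=
      mul_left_cancel₀ (pow_ne_zero k (by norm_num : (-1 : ℝ) ≠ 0))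
        ((hv φ hφ).symm.trans (hw φ hφ))
    have i1 := integrable_mul_test (J := I) hφ 0 v
    have i2 := integrable_mul_test (J := I) hφ 0 w
    simp only [iteratedDeriv_zero] at i1 i2
    rw [← sub_eq_zero, ← integral_sub i1 i2] at e
    rw [← e]
    refine integral_congr_ae ?_
    filter_upwards [Lp.coeFn_sub v w] with x hx
    simp only [hx, Pi.sub_apply, smul_eq_mul]
    ring

lemma Sob.ext_zero {s : ℕ} {I : Set ℝ} (hI : IsOpen I) {U V : Sob s I} (h : U.1 0 = V.1 0) :
    U = V := by
  refine Subtype.ext (PiLp.ext fun k => ?_)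
  have hU := U.2 k
  rw [h] at hU
  exact hU.unique hI (V.2 k)

/-- Makes the choice in `toSob` harmless: on an open set a function determines its weak derivatives.
-/
lemma toSob_eq {s : ℕ} {I : Set ℝ} (hI : IsOpen I) {U : Sob s I} {u : ℝ → ℝ}
    (h : (U.1 0 : L2 I) =ᵐ[volume.restrict I] u) : toSob s I u = U := by
  have hm : MemSob s I u := ⟨U, h⟩
  rw [toSob, dif_pos hm]
  exact Sob.ext_zero hI (Lp.ext (hm.choose_spec.trans h.symm))

lemma tendsto_Sob {s : ℕ} {I : Set ℝ} {ι : Type*} {l : Filter ι} {F : ι → Sob s I} {U : Sob s I}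
    (h : ∀ k, Tendsto (fun i => ((F i).1 k : L2 I)) l (𝓝 (U.1 k))) : Tendsto F l (𝓝 U) := by
  rw [tendsto_subtype_rng]
  exact ((PiLp.continuous_toLp 2 fun _ : Fin (s + 1) => L2 I).tendsto (WithLp.ofLp U.1)).comp
    (tendsto_pi_nhds.2 h)

/-- The restriction of functions as a map `L²(ℝ) → L²(I)`. -/
noncomputable def restrL2 (I : Set ℝ) : L2 univ →L[ℝ] L2 I :=
  LinearMap.mkContinuous
    { toFun := fun u => ((Lp.memLp u).mono_measure
        (Measure.restrict_mono (subset_univ I) le_rfl)).toLp u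
      map_add' := fun u v => by
        refine Lp.ext ?_
        have h := ae_mono (Measure.restrict_mono (μ := volume) (subset_univ I) le_rfl)
          (Lp.coeFn_add u v)
        refine (MemLp.coeFn_toLp _).trans (EventuallyEq.trans h ?_)
        refine EventuallyEq.trans ?_ (Lp.coeFn_add _ _).symm
        exact ((MemLp.coeFn_toLp _).add (MemLp.coeFn_toLp _)).symm
      map_smul' := fun c u => by
        refine Lp.ext ?_
        have h := ae_mono (Measure.restrict_mono (μ := volume) (subset_univ I) le_rfl)
          (Lp.coeFn_smul c u)
        refine (MemLp.coeFn_toLp _).trans (EventuallyEq.trans h ?_)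
        refine EventuallyEq.trans ?_ (Lp.coeFn_smul _ _).symm
        exact ((MemLp.coeFn_toLp _).const_smul c).symm }
    1 (fun u => by
      rw [one_mul]
      refine (Lp.norm_toLp _ ((Lp.memLp u).mono_measure
        (Measure.restrict_mono (subset_univ I) le_rfl))).trans_le ?_
      exact ENNReal.toReal_mono (Lp.memLp u).eLpNorm_ne_top
        (eLpNorm_mono_measure _ (Measure.restrict_mono (subset_univ I) le_rfl)))

/-- `restr` as a continuous linear map. -/
noncomputable def restrCLM (s : ℕ) (I : Set ℝ) : Sob s univ →L[ℝ] Sob s I where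
  toFun := restr s I
  map_add' U V := Subtype.ext (PiLp.ext fun k => map_add (restrL2 I) (U.1 k) (V.1 k))
  map_smul' c U := Subtype.ext (PiLp.ext fun k => map_smul (restrL2 I) c (U.1 k))
  cont := continuous_iff_continuousAt.2 fun _ => tendsto_Sob fun k =>
    ((restrL2 I).continuous.comp
      ((PiLp.continuous_apply 2 _ k).comp continuous_subtype_val)).continuousAt

lemma restr_ae {s : ℕ} {I : Set ℝ} (U : Sob s univ) {k : Fin (s + 1)} {u : ℝ → ℝ}
    (h : (U.1 k : L2 univ) =ᵐ[volume.restrict univ] u) :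
    ((restr s I U).1 k : L2 I) =ᵐ[volume.restrict I] u :=
  (MemLp.coeFn_toLp ((Lp.memLp (U.1 k : L2 univ)).mono_measure
    (Measure.restrict_mono (subset_univ I) le_rfl))).trans
    (ae_mono (Measure.restrict_mono (subset_univ I) le_rfl) h)

/-! ### Compactly supported functions in Sobolev spaces -/

lemma IsTest.deriv {I : Set ℝ} {φ : ℝ → ℝ} (h : IsTest I φ) : IsTest I (deriv φ) :=
  ⟨(contDiff_infty_iff_deriv.1 h.1).2, h.2.1.deriv,
    (closure_minimal support_deriv_subset (isClosed_tsupport _)).trans h.2.2⟩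

lemma hasCompactSupport_of_zero {K : Set ℝ} (hK : IsCompact K) {u : ℝ → ℝ}
    (h : ∀ x, x ∉ K → u x = 0) : HasCompactSupport u :=
  HasCompactSupport.intro hK fun x hx => h x hx

/-- Successive classical derivatives are weak derivatives. -/
lemma isWeakDeriv_of_hasDerivAt {s : ℕ} (I : Set ℝ) {u : ℕ → ℝ → ℝ}
    (hd : ∀ k < s, ∀ x, HasDerivAt (u k) (u (k + 1) x) x) (hc : ∀ k ≤ s, Continuous (u k)) :
    ∀ k ≤ s, IsWeakDeriv I k (u 0) (u k) := by
  intro k hk φ hφ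
  have hφ0 : Function.support φ ⊆ I := (subset_tsupport φ).trans hφ.2.2
  -- Over the whole line integration by parts has no boundary terms, since the test function has
  -- compact support.
  rw [← setIntegral_univ_eq_of_test (hφ.support_iteratedDeriv_subset k),
    ← setIntegral_univ_eq_of_test hφ0, Measure.restrict_univ]
  clear hφ0
  induction k generalizing φ with
  | zero => simp
  | succ k ih =>
    have hint : ∀ (j : ℕ), j ≤ s → ∀ ψ : ℝ → ℝ, IsTest I ψ → Integrable (u j * ψ) := by
      intro j hj ψ hψ
      exact ((hc j hj).mul hψ.1.continuous).integrable_of_hasCompactSupport hψ.2.1.mul_left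
    rw [iteratedDeriv_succ', ih (by omega) _ hφ.deriv,
      integral_mul_deriv_eq_deriv_mul_of_integrable (u' := u (k + 1)) (v := φ)
        (fun x _ => hd k (by omega) x)
        (fun x _ => (hφ.1.differentiable (by simp) x).hasDerivAt)
        (hint k (by omega) _ hφ.deriv) (hint _ hk _ hφ) (hint k (by omega) _ hφ)]
    ring

lemma memLp_of_continuous {K : Set ℝ} (hK : IsCompact K) {u : ℝ → ℝ} (hc : Continuous u)
    (h : ∀ x, x ∉ K → u x = 0) (I : Set ℝ) : MemLp u 2 (volume.restrict I) :=
  (hc.memLp_of_hasCompactSupport (hasCompactSupport_of_zero hK h)).restrict I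

lemma exists_sob_of_hasDerivAt {s : ℕ} (I : Set ℝ) {K : Set ℝ} (hK : IsCompact K)
    {u : ℕ → ℝ → ℝ} (hd : ∀ k < s, ∀ x, HasDerivAt (u k) (u (k + 1) x) x)
    (hc : ∀ k ≤ s, Continuous (u k)) (h0 : ∀ k ≤ s, ∀ x, x ∉ K → u k x = 0) :
    ∃ U : Sob s I, ∀ k : Fin (s + 1), (U.1 k : L2 I) =ᵐ[volume.restrict I] u k := by
  have hm : ∀ k : Fin (s + 1), MemLp (u k) 2 (volume.restrict I) := fun k =>
    memLp_of_continuous hK (hc k (by omega)) (h0 k (by omega)) I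
  refine ⟨⟨WithLp.toLp 2 fun k => (hm k).toLp, fun k => ?_⟩, fun k => (hm k).coeFn_toLp⟩
  exact (isWeakDeriv_of_hasDerivAt I hd hc k (by omega)).congr_ae
    (hm 0).coeFn_toLp.symm (hm k).coeFn_toLp.symm

/-- A function in `C^s` with compact support in `I` belongs to `H_0^s(I)`. -/
lemma mem_SobZero_of_hasDerivAt {s : ℕ} {I : Set ℝ} (hI : IsOpen I) {K : Set ℝ}
    (hK : IsCompact K) (hKI : K ⊆ I) {u : ℕ → ℝ → ℝ}
    (hd : ∀ k < s, ∀ x, HasDerivAt (u k) (u (k + 1) x) x)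
    (hc : ∀ k ≤ s, Continuous (u k)) (h0 : ∀ k ≤ s, ∀ x, x ∉ K → u k x = 0)
    {U : Sob s I} (hU : ∀ k : Fin (s + 1), (U.1 k : L2 I) =ᵐ[volume.restrict I] u k) :
    U ∈ SobZero s I := by
  obtain ⟨δ, hδ, hδI⟩ := hK.exists_cthickening_subset_open hI hKI
  -- Radii at most `δ` keep all mollifications supported in the closed `δ`-thickening of `K`, which
  -- lies in `I`.
  let B : ℕ → ContDiffBump (0 : ℝ) := fun n =>
    ⟨δ / (n + 1) / 2, δ / (n + 1), by positivity, half_lt_self (by positivity)⟩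
  have hBout : ∀ n, (B n).rOut = δ / (n + 1) := fun n => rfl
  let m : ℕ → ℕ → ℝ → ℝ := fun n k =>
    convolution ((B n).normed volume) (u k) (ContinuousLinearMap.lsmul ℝ ℝ) volume
  have hcs : ∀ k ≤ s, HasCompactSupport (u k) := fun k hk => hasCompactSupport_of_zero hK (h0 k hk)
  have hsm : ∀ n, ∀ k ≤ s, ContDiff ℝ ∞ (m n k) := fun n k hk =>
    (B n).hasCompactSupport_normed.contDiff_convolution_left _ (B n).contDiff_normed
      (hc k hk).locallyIntegrable
  have hmd : ∀ n, ∀ k < s, ∀ x, HasDerivAt (m n k) (m n (k + 1) x) x := by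
    intro n k hk x
    have hder : _root_.deriv (u k) = u (k + 1) := funext fun x => (hd k hk x).deriv
    have h1 : ContDiff ℝ 1 (u k) := by
      rw [contDiff_one_iff_deriv, hder]
      exact ⟨fun x => (hd k hk x).differentiableAt, hc (k + 1) hk⟩
    have := (hcs k hk.le).hasDerivAt_convolution_right (ContinuousLinearMap.lsmul ℝ ℝ)
      (μ := volume) (f₀ := (B n).normed volume)
      (B n).continuous_normed.locallyIntegrable h1 x
    rwa [hder] at this
  have hm0 : ∀ n, ∀ k ≤ s, ∀ x, x ∉ Metric.cthickening δ K → m n k x = 0 := by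
    intro n k hk x hx
    by_contra hne
    refine hx ?_
    obtain ⟨y, hy, z, hz, rfl⟩ := support_convolution_subset (ContinuousLinearMap.lsmul ℝ ℝ)
      (show x ∈ Function.support (m n k) from hne)
    have hzK : z ∈ K := by
      by_contra hz'
      exact hz (h0 k hk z hz')
    rw [(B n).support_normed_eq, hBout] at hy
    refine Metric.mem_cthickening_of_dist_le (y + z) z δ K hzK ?_
    have : |y| < δ / (n + 1) := by simpa using hy
    rw [Real.dist_eq, add_sub_cancel_right]
    refine this.le.trans (div_le_self hδ.le ?_)
    linarith [n.cast_nonneg (α := ℝ)]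
  have hK' : IsCompact (Metric.cthickening δ K) := hK.cthickening
  choose V hV using fun n => exists_sob_of_hasDerivAt I hK' (hmd n)
    (fun k hk => (hsm n k hk).continuous) (hm0 n)
  have hVU : Tendsto V atTop (𝓝 U) := by
    refine tendsto_Sob fun k => ?_
    have hks : (k : ℕ) ≤ s := by omega
    -- Uniform continuity of `u k` makes the mollifications converge uniformly; on a common bounded
    -- support this gives convergence in `L²`.
    have huc : ∀ ε > 0, ∀ᶠ n in atTop, ∀ x, |m n k x - u k x| ≤ ε := by
      intro ε hε
      obtain ⟨η, hη, hη'⟩ := Metric.uniformContinuous_iff.1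
        ((hcs k hks).uniformContinuous_of_continuous (hc k hks)) ε hε
      have hlim : Tendsto (fun n : ℕ => δ / ((n : ℝ) + 1)) atTop (𝓝 0) :=
        tendsto_const_nhds.div_atTop
          (tendsto_natCast_atTop_atTop.atTop_add tendsto_const_nhds)
      filter_upwards [hlim.eventually (gt_mem_nhds hη)] with n hn x
      refine ContDiffBump.dist_normed_convolution_le (hc k hks).aestronglyMeasurable
        fun y hy => (hη' ?_).le
      exact (Metric.mem_ball.1 hy).trans hn
    refine tendsto_Lp_of_dominated (fun n => hV n k) (hU k)
      (b := (Metric.cthickening δ K).indicator fun _ => 1) ?_ ?_ ?_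
    · exact memLp_indicator_const 2 hK'.measurableSet 1
        (Or.inr ((Measure.restrict_apply_le _ _).trans_lt hK'.measure_lt_top).ne)
    · filter_upwards [huc 1 one_pos] with n hn
      refine Eventually.of_forall fun x => ?_
      by_cases hx : x ∈ Metric.cthickening δ K
      · rw [indicator_of_mem hx]; exact hn x
      · rw [indicator_of_notMem hx, hm0 n k hks x hx,
          h0 k hks x fun h => hx (Metric.self_subset_cthickening K h)]
        simp
    · refine Eventually.of_forall fun x => ?_
      rw [Metric.tendsto_nhds]
      intro ε hε
      filter_upwards [huc (ε / 2) (half_pos hε)] with n hn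
      exact (hn x).trans_lt (half_lt_self hε)
  refine (Submodule.isClosed_topologicalClosure _).mem_of_tendsto hVU
    (Eventually.of_forall fun n => ?_)
  refine Submodule.le_topologicalClosure _ (Submodule.subset_span ⟨m n 0, ⟨hsm n 0 s.zero_le,
    hasCompactSupport_of_zero hK' (hm0 n 0 s.zero_le), ?_⟩, hV n 0⟩)
  refine (closure_minimal (fun x hx => ?_) Metric.isClosed_cthickening).trans hδI
  by_contra hx'
  exact hx (hm0 n 0 s.zero_le x hx')

/-! ### Truncated powers as elements of `L²` -/

lemma abs_truncPow_le (q : ℕ) {y r : ℝ} (h : |y| ≤ r) : |truncPow q y| ≤ r ^ q := by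
  have hr : 0 ≤ r := (abs_nonneg y).trans h
  unfold truncPow
  split_ifs
  · rw [abs_pow]; gcongr
  · rw [abs_zero]; positivity

/-- A bounded measurable function restricted to a compact interval is square integrable. -/
lemma memLp_indicator_of_bound {f : ℝ → ℝ} (hf : Measurable f) {R C : ℝ}
    (hC : ∀ x ∈ Icc (-R) R, |f x| ≤ C) (J : Set ℝ) :
    MemLp ((Icc (-R) R).indicator f) 2 (volume.restrict J) := by
  have hm : MemLp ((Icc (-R) R).indicator fun _ => C) 2 (volume.restrict J) :=
    memLp_indicator_const 2 measurableSet_Icc C (Or.inr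
      ((Measure.restrict_apply_le _ _).trans_lt measure_Icc_lt_top).ne)
  refine hm.mono (hf.indicator measurableSet_Icc).aestronglyMeasurable
    (Eventually.of_forall fun x => ?_)
  by_cases hx : x ∈ Icc (-R) R
  · rw [indicator_of_mem hx, indicator_of_mem hx]
    exact (hC x hx).trans (le_abs_self C)
  · rw [indicator_of_notMem hx, indicator_of_notMem hx]

lemma memLp_truncPow (J : Set ℝ) (R : ℝ) (q : ℕ) (t : ℝ) :
    MemLp ((Icc (-R) R).indicator fun x => truncPow q (t - x)) 2 (volume.restrict J) := by
  refine memLp_indicator_of_bound ((measurable_truncPow q).comp (by fun_prop))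
    (C := (|t| + R) ^ q) (fun x hx => abs_truncPow_le q ?_) J
  exact (abs_sub _ _).trans (add_le_add le_rfl (abs_le.2 hx))

/-- The truncated power `(t - •)₊ ^ q`, cut off outside `[-R, R]`, as an element of `L²(J)`. -/
noncomputable def truncL2 (J : Set ℝ) (R : ℝ) (q : ℕ) (t : ℝ) : L2 J :=
  (memLp_truncPow J R q t).toLp

lemma truncL2_ae (J : Set ℝ) (R : ℝ) (q : ℕ) (t : ℝ) :
    truncL2 J R q t =ᵐ[volume.restrict J] (Icc (-R) R).indicator fun x => truncPow q (t - x) :=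
  MemLp.coeFn_toLp _

/-- The pointwise derivative in `t` may fail to exist only at `x = t`, a null set. This is what
admits exponent one, whose derivative has a jump. -/
lemma differentiable_truncL2 (J : Set ℝ) (R : ℝ) {q : ℕ} (hq : 1 ≤ q) :
    Differentiable ℝ (truncL2 J R q) := by
  obtain ⟨q, rfl⟩ := Nat.exists_eq_add_of_le' hq
  intro t
  have hG' : ((q + 1 : ℝ) • truncL2 J R q t : L2 J) =ᵐ[volume.restrict J]
      (Icc (-R) R).indicator fun x => (q + 1) * truncPow q (t - x) := by
    filter_upwards [Lp.coeFn_smul (q + 1 : ℝ) (truncL2 J R q t), truncL2_ae J R q t] with x h1 h2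
    rw [h1, Pi.smul_apply, h2, smul_eq_mul]
    by_cases hx : x ∈ Icc (-R) R
    · rw [indicator_of_mem hx, indicator_of_mem hx]
    · rw [indicator_of_notMem hx, indicator_of_notMem hx, mul_zero]
  -- For `|r - t| < 1` and `|x| ≤ R` both positive parts are at most `|t| + 1 + R`; the constant
  -- then comes from the Lipschitz bound for the power.
  refine (hasDerivAt_Lp_of_dominated (truncL2_ae J R (q + 1)) hG'
    (b := (Icc (-R) R).indicator fun _ => ((q + 1 : ℕ) : ℝ) * (|t| + 1 + R) ^ q)
    (memLp_indicator_of_bound measurable_const (fun x _ => le_rfl) J)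
    ?_ ?_).differentiableAt
  · filter_upwards [Metric.ball_mem_nhds t one_pos] with r hr
    refine Eventually.of_forall fun x => ?_
    by_cases hx : x ∈ Icc (-R) R
    · simp only [indicator_of_mem hx, truncPow_succ]
      have hxR : |x| ≤ R := abs_le.2 hx
      have hr1 : |r| ≤ |t| + 1 := by
        have h1 : |r - t| < 1 := hr
        have h2 : |r| ≤ |r - t| + |t| := by simpa using abs_add_le (r - t) t
        linarith
      have hb : ∀ y : ℝ, |y| ≤ |t| + 1 → |max (y - x) 0| ≤ |t| + 1 + R := fun y hy => by
        refine (abs_max_le_max_abs_abs).trans (max_le ?_ ?_)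
        · exact (abs_sub _ _).trans (add_le_add hy hxR)
        · rw [abs_zero]; linarith [abs_nonneg t, abs_nonneg x]
      have h3 : |max (r - x) 0 - max (t - x) 0| ≤ |r - t| := by
        have := abs_max_sub_max_le_abs (r - x) (t - x) 0
        simpa using this
      refine (abs_pow_sub_pow_le _ _ _).trans ?_
      rw [mul_assoc, mul_comm]
      refine mul_le_mul (mul_le_mul_of_nonneg_left ?_ (Nat.cast_nonneg _)) h3 (abs_nonneg _) ?_
      · exact pow_le_pow_left₀ (le_max_of_le_left (abs_nonneg _))
          (max_le (hb r hr1) (hb t (by linarith))) _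
      · have := abs_nonneg t
        have := abs_nonneg x
        have : 0 ≤ R := (abs_nonneg x).trans hxR
        positivity
    · simp only [indicator_of_notMem hx]; simp
  · have hne : ∀ᵐ x ∂(volume.restrict J), x ≠ t :=
      ae_restrict_of_ae (Measure.ae_ne volume t)
    filter_upwards [hne] with x hxt
    by_cases hx : x ∈ Icc (-R) R
    · simp only [indicator_of_mem hx]
      exact (hasDerivAt_truncPow_of_ne q (sub_ne_zero.2 hxt.symm)).comp_sub_const t x
    · simp only [indicator_of_notMem hx]
      exact hasDerivAt_const _ _

/-! ### B-splines in Sobolev spaces -/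

/-- The derivative of order `k` of `bspline p τ`. -/
noncomputable def bsplineDeriv (p k : ℕ) (τ : Fin (p + 2) → ℝ) (x : ℝ) : ℝ :=
  (-1) ^ k * (p.descFactorial k : ℝ) * spline p (p - k) τ x

lemma bsplineDeriv_zero (p : ℕ) (τ : Fin (p + 2) → ℝ) : bsplineDeriv p 0 τ = bspline p τ := by
  funext x
  simp [bsplineDeriv, spline, bspline]

lemma continuous_bsplineDeriv {p : ℕ} (hp : 1 ≤ p) (τ : Fin (p + 2) → ℝ) :
    ∀ k ≤ p - 1, Continuous (bsplineDeriv p k τ) := fun k hk =>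
  continuous_const.mul (continuous_spline (by omega) τ)

/-- For `k < p - 1` the exponent `p - k` is at least two, so the truncated powers involved are
continuously differentiable. -/
lemma hasDerivAt_bsplineDeriv {p : ℕ} (τ : Fin (p + 2) → ℝ) :
    ∀ k < p - 1, ∀ x, HasDerivAt (bsplineDeriv p k τ) (bsplineDeriv p (k + 1) τ x) x := by
  intro k hk x
  obtain ⟨m, rfl⟩ : ∃ m, p = k + 1 + m := ⟨p - (k + 1), by omega⟩
  have e1 : k + 1 + m - k = m + 1 := by omega
  have e2 : k + 1 + m - (k + 1) = m := by omega
  have h := (hasDerivAt_spline (p := k + 1 + m) (q := m) (by omega) τ x).const_mul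
    ((-1) ^ k * ((k + 1 + m).descFactorial k : ℝ))
  unfold bsplineDeriv
  rw [e1, e2]
  refine h.congr_deriv ?_
  rw [Nat.descFactorial_succ, e1]
  push_cast
  ring

lemma bsplineDeriv_eq_zero {p : ℕ} {τ : Fin (p + 2) → ℝ} (hτ : τ ∈ knots (p + 2)) :
    ∀ k ≤ p - 1, ∀ x, x ∉ Icc (τ 0) (τ (Fin.last (p + 1))) → bsplineDeriv p k τ x = 0 :=
  fun k _ x hx => by rw [bsplineDeriv, spline_eq_zero (by omega) hτ hx, mul_zero]

lemma bsplineSob_spec {p : ℕ} (hp : 1 ≤ p) {τ : Fin (p + 2) → ℝ} (hτ : τ ∈ knots (p + 2)) :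
    MemSob (p - 1) univ (bspline p τ) ∧ ∀ k : Fin (p - 1 + 1),
      ((bsplineSob p τ).1 k : L2 univ) =ᵐ[volume.restrict univ] bsplineDeriv p k τ := by
  obtain ⟨U, hU⟩ := exists_sob_of_hasDerivAt univ (isCompact_Icc (a := τ 0))
    (hasDerivAt_bsplineDeriv τ) (continuous_bsplineDeriv hp τ) (bsplineDeriv_eq_zero hτ)
  have h0 : (U.1 0 : L2 univ) =ᵐ[volume.restrict univ] bspline p τ := by
    rw [← bsplineDeriv_zero]
    exact hU 0
  refine ⟨⟨U, h0⟩, fun k => ?_⟩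
  rw [bsplineSob, toSob_eq isOpen_univ h0]
  exact hU k

/-- Single truncated powers are not square integrable on the line, but their combination vanishes
outside `[-R, R]`, so each may be cut off there. With `R` fixed, only the weights, the prefactor and
`truncL2` depend on the knots. -/
lemma bsplineSob_eq_sum {p : ℕ} (hp : 1 ≤ p) {τ : Fin (p + 2) → ℝ} (hτ : τ ∈ knots (p + 2))
    {R : ℝ} (h1 : -R ≤ τ 0) (h2 : τ (Fin.last (p + 1)) ≤ R) (k : Fin (p - 1 + 1)) :
    (bsplineSob p τ).1 k =
      ((-1) ^ (k : ℕ) * (p.descFactorial k : ℝ) * (τ (Fin.last (p + 1)) - τ 0)) •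
        ∑ j, ddWeight (p + 1) τ j • truncL2 univ R (p - k) (τ j) := by
  refine Lp.ext (((bsplineSob_spec hp hτ).2 k).trans ?_)
  have hall : ∀ᵐ x ∂(volume.restrict (univ : Set ℝ)), ∀ j,
      (ddWeight (p + 1) τ j • truncL2 univ R (p - k) (τ j) : L2 univ) x =
        ddWeight (p + 1) τ j * (Icc (-R) R).indicator (fun x => truncPow (p - k) (τ j - x)) x := by
    refine ae_all_iff.2 fun j => ?_
    filter_upwards [Lp.coeFn_smul (ddWeight (p + 1) τ j) (truncL2 univ R (p - k) (τ j)),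
      truncL2_ae univ R (p - k) (τ j)] with x e1 e2
    rw [e1, Pi.smul_apply, e2, smul_eq_mul]
  filter_upwards [hall, Lp.coeFn_smul
      ((-1) ^ (k : ℕ) * (p.descFactorial k : ℝ) * (τ (Fin.last (p + 1)) - τ 0))
      (∑ j, ddWeight (p + 1) τ j • truncL2 univ R (p - k) (τ j)),
    Lp.coeFn_finsetSum Finset.univ
      (fun j => ddWeight (p + 1) τ j • truncL2 univ R (p - k) (τ j))] with x e1 e2 e3
  rw [e2, Pi.smul_apply, e3, Finset.sum_apply, smul_eq_mul]
  simp only [e1]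
  by_cases hx : x ∈ Icc (-R) R
  · simp only [indicator_of_mem hx]
    rw [bsplineDeriv, spline_eq_sum]
    ring
  · simp only [indicator_of_notMem hx]
    rw [bsplineDeriv_eq_zero hτ k (by omega) x fun h => hx ⟨h1.trans h.1, h.2.trans h2⟩]
    simp

/-- B-splines are differentiable with respect to the knots in the Sobolev norm. -/
lemma differentiableAt_bsplineSob {p : ℕ} (hp : 1 ≤ p) {τ : Fin (p + 2) → ℝ}
    (hτ : τ ∈ knots (p + 2)) : DifferentiableAt ℝ (bsplineSob p) τ := by
  refine differentiableAt_submodule ?_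
  rw [differentiableAt_piLp]
  intro k
  -- Strictly larger than needed at `τ`, so that one `R` serves all nearby knot vectors.
  set R := |τ 0| + |τ (Fin.last (p + 1))| + 1 with hR
  have hev : (fun σ => ((bsplineSob p σ).1 k : L2 univ)) =ᶠ[𝓝 τ] fun σ =>
      ((-1) ^ (k : ℕ) * (p.descFactorial k : ℝ) * (σ (Fin.last (p + 1)) - σ 0)) •
        ∑ j, ddWeight (p + 1) σ j • truncL2 univ R (p - k) (σ j) := by
    have c0 : ∀ᶠ σ in 𝓝 τ, -R < σ 0 :=
      (continuous_apply (0 : Fin (p + 2))).continuousAt.eventually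
        (lt_mem_nhds (by linarith [neg_abs_le (τ 0), abs_nonneg (τ (Fin.last (p + 1)))]))
    have c1 : ∀ᶠ σ in 𝓝 τ, σ (Fin.last (p + 1)) < R :=
      (continuous_apply (Fin.last (p + 1))).continuousAt.eventually
        (gt_mem_nhds (by linarith [le_abs_self (τ (Fin.last (p + 1))), abs_nonneg (τ 0)]))
    filter_upwards [(isOpen_knots _).mem_nhds hτ, c0, c1] with σ hσ h0 h1
    exact bsplineSob_eq_sum hp hσ h0.le h1.le k
  refine DifferentiableAt.congr_of_eventuallyEq ?_ hev
  have hV : ∀ j : Fin (p + 2), DifferentiableAt ℝ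
      (fun σ : Fin (p + 2) → ℝ => truncL2 univ R (p - k) (σ j)) τ := fun j =>
    DifferentiableAt.comp (g := truncL2 univ R (p - k)) τ
      (differentiable_truncL2 univ R (by omega) (τ j)) (differentiableAt_apply j τ)
  refine DifferentiableAt.fun_smul (by fun_prop) (DifferentiableAt.fun_sum fun j _ => ?_)
  exact (differentiableAt_ddWeight (p + 1) hτ j).fun_smul (hV j)

/-! ### Knot vectors with B-splines supported in `I` -/

lemma restr_bsplineSob_mem_of_Icc_subset {p : ℕ} (hp : 1 ≤ p) {I : Set ℝ} (hI : IsOpen I)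
    {τ : Fin (p + 2) → ℝ} (hτ : τ ∈ knots (p + 2))
    (h : Icc (τ 0) (τ (Fin.last (p + 1))) ⊆ I) :
    restr (p - 1) I (bsplineSob p τ) ∈ SobZero (p - 1) I :=
  mem_SobZero_of_hasDerivAt hI isCompact_Icc h (hasDerivAt_bsplineDeriv τ)
    (continuous_bsplineDeriv hp τ) (bsplineDeriv_eq_zero hτ)
    fun k => restr_ae _ ((bsplineSob_spec hp hτ).2 k)

lemma isClosed_SobZero (s : ℕ) (I : Set ℝ) : IsClosed (SobZero s I : Set (Sob s I)) :=
  Submodule.isClosed_topologicalClosure _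

/-- Contracting the knots towards the midpoint of their span by a factor `r < 1` brings the closed
span into `I`; as `r → 1` the splines converge in `H^{p-1}(I)`, and the subspace is closed. -/
lemma restr_bsplineSob_mem {p : ℕ} (hp : 1 ≤ p) {I : Set ℝ} (hI : IsOpen I)
    {τ : Fin (p + 2) → ℝ} (hτ : τ ∈ knotsIn p I) :
    restr (p - 1) I (bsplineSob p τ) ∈ SobZero (p - 1) I := by
  have h0 := zero_lt_last_of_mem_knots hτ.1
  set a := τ 0 with ha
  set b := τ (Fin.last (p + 1)) with hb
  let σ : ℝ → Fin (p + 2) → ℝ := fun r j => (a + b) / 2 + r * (τ j - (a + b) / 2)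
  have hσ1 : σ 1 = τ := funext fun j => by simp [σ]
  have hσc : Continuous σ := by fun_prop
  have hd : DifferentiableAt ℝ (fun σ => restr (p - 1) I (bsplineSob p σ)) (σ 1) := by
    rw [hσ1]
    exact (restrCLM (p - 1) I).differentiableAt.comp τ (differentiableAt_bsplineSob hp hτ.1)
  have hlim : Tendsto (fun r => restr (p - 1) I (bsplineSob p (σ r))) (𝓝[<] 1)
      (𝓝 (restr (p - 1) I (bsplineSob p τ))) := by
    have : ContinuousAt (fun r => restr (p - 1) I (bsplineSob p (σ r))) 1 :=
      ContinuousAt.comp (f := σ) hd.continuousAt hσc.continuousAt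
    have h2 := this.tendsto.mono_left (nhdsWithin_le_nhds (s := Iio 1))
    rwa [hσ1] at h2
  refine (isClosed_SobZero (p - 1) I).mem_of_tendsto hlim ?_
  filter_upwards [self_mem_nhdsWithin,
    nhdsWithin_le_nhds (lt_mem_nhds (zero_lt_one (α := ℝ)))] with r hr1 hr0
  have hr1' : r < 1 := hr1
  refine restr_bsplineSob_mem_of_Icc_subset hp hI ?_ ?_
  · intro i j hij
    have := hτ.1 hij
    simp only [σ]
    nlinarith
  · refine Subset.trans (fun x hx => ?_) hτ.2
    have h1 : (a + b) / 2 + r * (a - (a + b) / 2) ≤ x := hx.1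
    have h2 : x ≤ (a + b) / 2 + r * (b - (a + b) / 2) := hx.2
    constructor <;> nlinarith

/-- Difference quotients along `S` lie in `K`, and a one-sided approach already determines the
derivative. -/
lemma hasDerivAt_mem_of_eventually {H : Type*} [NormedAddCommGroup H] [NormedSpace ℝ H]
    {K : Submodule ℝ H} (hK : IsClosed (K : Set H)) {F : ℝ → H} {F' : H} {t : ℝ}
    (hF : HasDerivAt F F' t) {S : Set ℝ} (hS : t ∉ S) [(𝓝[S] t).NeBot]
    (h : ∀ᶠ r in 𝓝[S] t, F r ∈ K) (ht : F t ∈ K) : F' ∈ K := by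
  refine hK.mem_of_tendsto
    ((hasDerivWithinAt_iff_tendsto_slope' hS).1 (hF.hasDerivWithinAt (s := S))) ?_
  filter_upwards [h] with r hr
  rw [slope_def_module]
  exact K.smul_mem _ (K.sub_mem hr ht)

lemma differentiableAt_update {n : ℕ} (τ : Fin n → ℝ) (i : Fin n) (t : ℝ) :
    DifferentiableAt ℝ (fun r : ℝ => Function.update τ i r) t :=
  (hasDerivAt_update τ i t).differentiableAt

lemma differentiableAt_comp_update {n : ℕ} {E : Type*} [NormedAddCommGroup E] [NormedSpace ℝ E]
    {F : (Fin n → ℝ) → E} {τ : Fin n → ℝ} (h : DifferentiableAt ℝ F τ) (i : Fin n) :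
    DifferentiableAt ℝ (fun r : ℝ => F (Function.update τ i r)) (τ i) := by
  refine DifferentiableAt.comp (g := F) (τ i) ?_ (differentiableAt_update τ i (τ i))
  rwa [Function.update_eq_self]

lemma hasDerivAt_bsplineSob {p : ℕ} (hp : 1 ≤ p) {τ : Fin (p + 2) → ℝ} (hτ : τ ∈ knots (p + 2))
    (i : Fin (p + 2)) : HasDerivAt (fun t : ℝ => bsplineSob p (Function.update τ i t))
      (partialBspline p i τ) (τ i) :=
  (differentiableAt_comp_update (differentiableAt_bsplineSob hp hτ) i).hasDerivAt

lemma hasDerivAt_restr_bsplineSob {p : ℕ} (hp : 1 ≤ p) (I : Set ℝ) {τ : Fin (p + 2) → ℝ}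
    (hτ : τ ∈ knots (p + 2)) (i : Fin (p + 2)) :
    HasDerivAt (fun t : ℝ => restr (p - 1) I (bsplineSob p (Function.update τ i t)))
      (restr (p - 1) I (partialBspline p i τ)) (τ i) :=
  (restrCLM (p - 1) I).hasFDerivAt.comp_hasDerivAt (τ i) (hasDerivAt_bsplineSob hp hτ i)

lemma eventually_update_mem_knots {n : ℕ} {τ : Fin n → ℝ} (hτ : τ ∈ knots n) (i : Fin n) :
    ∀ᶠ t in 𝓝 (τ i), Function.update τ i t ∈ knots n := by
  refine (differentiableAt_update τ i (τ i)).continuousAt.eventually ?_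
  beta_reduce
  rw [Function.update_eq_self]
  exact (isOpen_knots n).mem_nhds hτ

/-- Moving the first knot to the right, or any other to the left, never enlarges the span of the
knots, so difference quotients from that side stay in the subspace. -/
lemma restr_partialBspline_mem {p : ℕ} (hp : 1 ≤ p) {I : Set ℝ} (hI : IsOpen I)
    {τ : Fin (p + 2) → ℝ} (hτ : τ ∈ knotsIn p I) (i : Fin (p + 2)) :
    restr (p - 1) I (partialBspline p i τ) ∈ SobZero (p - 1) I := by
  have hK := isClosed_SobZero (p - 1) I
  have hd := hasDerivAt_restr_bsplineSob hp I hτ.1 i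
  have ht : restr (p - 1) I (bsplineSob p (Function.update τ i (τ i))) ∈ SobZero (p - 1) I := by
    rw [Function.update_eq_self]
    exact restr_bsplineSob_mem hp hI hτ
  have hev := eventually_update_mem_knots hτ.1 i
  by_cases hi : i = 0
  · refine hasDerivAt_mem_of_eventually hK hd (S := Ioi (τ i)) (by simp) ?_ ht
    filter_upwards [self_mem_nhdsWithin, nhdsWithin_le_nhds hev] with t h1 h2
    refine restr_bsplineSob_mem hp hI ⟨h2, (Ioo_subset_Ioo ?_ ?_).trans hτ.2⟩
    · subst hi
      rw [Function.update_self]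
      exact le_of_lt h1
    · rw [Function.update_of_ne (by rw [hi]; exact Fin.last_pos.ne')]
  · refine hasDerivAt_mem_of_eventually hK hd (S := Iio (τ i)) (by simp) ?_ ht
    filter_upwards [self_mem_nhdsWithin, nhdsWithin_le_nhds hev] with t h1 h2
    refine restr_bsplineSob_mem hp hI ⟨h2, (Ioo_subset_Ioo ?_ ?_).trans hτ.2⟩
    · rw [Function.update_of_ne (Ne.symm hi)]
    · by_cases hl : Fin.last (p + 1) = i
      · subst hl
        rw [Function.update_self]
        exact le_of_lt h1
      · rw [Function.update_of_ne hl]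

/-- Functionals on `H_0^s(I)` extend to `H^s(I)`. -/
noncomputable def extendDual {s : ℕ} {I : Set ℝ} (f : SobZero s I →L[ℝ] ℝ) : Sob s I →L[ℝ] ℝ :=
  f.comp (SobZero s I).orthogonalProjectionOnto

lemma pairZero_eq {s : ℕ} {I : Set ℝ} (f : SobZero s I →L[ℝ] ℝ) {u : Sob s I}
    (hu : u ∈ SobZero s I) : pairZero f u = extendDual f u := by
  rw [pairZero, dif_pos hu]
  exact congrArg f (Submodule.orthogonalProjectionOnto_mem_subspace_eq_self
    (⟨u, hu⟩ : SobZero s I)).symm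

/-! ### Step functions as functionals on `H¹(I)` -/

/-- The (signed) indicator function of the interval between `a` and `t`. -/
noncomputable def step (a t x : ℝ) : ℝ := truncPow 0 (t - x) - truncPow 0 (a - x)

/-- No ordering of the knots is needed: for coincident knots both sides vanish. -/
lemma bspline_zero_eq_step (τ : Fin 2 → ℝ) : bspline 0 τ = step (τ 0) (τ 1) := by
  funext x
  have : bspline 0 τ x = (τ 1 - τ 0) *
      ((truncPow 0 (τ 1 - x) - truncPow 0 (τ 0 - x)) / (τ 1 - τ 0)) := rfl
  rw [this, step]
  rcases eq_or_ne (τ 1) (τ 0) with h | h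
  · simp [h]
  · field_simp [sub_ne_zero.2 h]

lemma truncPow_zero_of_pos {y : ℝ} (hy : 0 < y) : truncPow 0 y = 1 := by simp [truncPow, hy]

lemma truncPow_of_nonpos (q : ℕ) {y : ℝ} (hy : y ≤ 0) : truncPow q y = 0 := if_neg hy.not_gt

lemma measurable_step (a t : ℝ) : Measurable (step a t) :=
  ((measurable_truncPow 0).comp (measurable_const.sub measurable_id)).sub
    ((measurable_truncPow 0).comp (measurable_const.sub measurable_id))

lemma step_eq_zero {a t δ x : ℝ} (ht : |t - a| < δ) (hx : δ ≤ |x - a|) : step a t x = 0 := by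
  rw [abs_lt] at ht
  rcases le_abs'.1 hx with h | h
  · rw [step, truncPow_zero_of_pos (by linarith), truncPow_zero_of_pos (by linarith), sub_self]
  · rw [step, truncPow_of_nonpos 0 (by linarith), truncPow_of_nonpos 0 (by linarith), sub_self]

lemma memLp_step (a t : ℝ) (J : Set ℝ) : MemLp (step a t) 2 (volume.restrict J) := by
  have h : step a t = (Icc (-(|a| + |t - a| + 1)) (|a| + |t - a| + 1)).indicator (step a t) := by
    funext x
    by_cases hx : x ∈ Icc (-(|a| + |t - a| + 1)) (|a| + |t - a| + 1)
    · rw [indicator_of_mem hx]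
    · rw [indicator_of_notMem hx]
      refine step_eq_zero (δ := |t - a| + 1) (by linarith) ?_
      by_contra! h
      refine hx (abs_le.1 ?_)
      have : |x| ≤ |x - a| + |a| := by simpa using abs_add_le (x - a) a
      linarith
  rw [h]
  refine memLp_indicator_of_bound (measurable_step a t) (C := 2) (fun x _ => ?_) J
  refine (abs_sub _ _).trans ?_
  have h1 := abs_truncPow_le 0 (le_refl |t - x|)
  have h2 := abs_truncPow_le 0 (le_refl |a - x|)
  rw [pow_zero] at h1 h2
  linarith

/-! ### A smooth approximation of the ramp function -/

/-- The rescalings `ρ (N y) / N` are smooth approximations of the positive part; their derivatives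
are bounded uniformly in `N` and converge to the indicator of `(0, ∞)` away from `0`. -/
lemma exists_smooth_ramp : ∃ ρ : ℝ → ℝ, ContDiff ℝ ∞ ρ ∧ (∀ y ≤ 0, ρ y = 0) ∧
    (∀ y, 1 ≤ y → ρ y = y) ∧ (∀ y, |ρ y| ≤ |y|) ∧ (∀ y < 0, deriv ρ y = 0) ∧
    (∀ y, 1 < y → deriv ρ y = 1) ∧ ∃ C, ∀ y, |deriv ρ y| ≤ C := by
  have hcd : ContDiff ℝ ∞ fun y : ℝ => y * Real.smoothTransition y :=
    contDiff_id.mul Real.smoothTransition.contDiff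
  have hz : ∀ y ≤ 0, y * Real.smoothTransition y = 0 := fun y hy => by
    rw [Real.smoothTransition.zero_of_nonpos hy, mul_zero]
  have ho : ∀ y, 1 ≤ y → y * Real.smoothTransition y = y := fun y hy => by
    rw [Real.smoothTransition.one_of_one_le hy, mul_one]
  have hdz : ∀ y < 0, deriv (fun y : ℝ => y * Real.smoothTransition y) y = 0 := by
    intro y hy
    have : (fun y : ℝ => y * Real.smoothTransition y) =ᶠ[𝓝 y] fun _ => 0 := by
      filter_upwards [Iio_mem_nhds hy] with z hz'
      exact hz z (le_of_lt hz')
    rw [this.deriv_eq, deriv_const]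
  have hdo : ∀ y, 1 < y → deriv (fun y : ℝ => y * Real.smoothTransition y) y = 1 := by
    intro y hy
    have : (fun y : ℝ => y * Real.smoothTransition y) =ᶠ[𝓝 y] fun y => y := by
      filter_upwards [Ioi_mem_nhds hy] with z hz'
      exact ho z (le_of_lt hz')
    rw [this.deriv_eq, deriv_id'']
  refine ⟨_, hcd, hz, ho, fun y => ?_, hdz, hdo, ?_⟩
  · rw [abs_mul, abs_of_nonneg (Real.smoothTransition.nonneg y)]
    exact mul_le_of_le_one_right (abs_nonneg y) (Real.smoothTransition.le_one y)
  · obtain ⟨C, hC⟩ := (isCompact_Icc (a := (0 : ℝ)) (b := 1)).exists_bound_of_continuousOn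
      (hcd.continuous_deriv (by simp)).continuousOn
    refine ⟨max C 1, fun y => ?_⟩
    rcases lt_or_ge y 0 with h | h
    · rw [hdz y h, abs_zero]; exact le_max_of_le_right zero_le_one
    rcases lt_or_ge 1 y with h' | h'
    · rw [hdo y h', abs_one]; exact le_max_right _ _
    · exact le_max_of_le_left (hC y ⟨h, h'⟩)

/-- Weak derivatives can be tested with dominated limits of test functions. -/
lemma integral_mul_of_tendsto {I : Set ℝ} (g : Sob 1 I) {φ : ℕ → ℝ → ℝ} {ψ ψ' b : ℝ → ℝ}
    (hφ : ∀ᶠ n in atTop, IsTest I (φ n)) (hb : MemLp b 2 (volume.restrict I))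
    (h0 : ∀ᶠ n in atTop, ∀ x, |φ n x| ≤ b x) (h1 : ∀ᶠ n in atTop, ∀ x, |deriv (φ n) x| ≤ b x)
    (hψ : ∀ᵐ x ∂volume.restrict I, Tendsto (fun n => φ n x) atTop (𝓝 (ψ x)))
    (hψ' : ∀ᵐ x ∂volume.restrict I, Tendsto (fun n => deriv (φ n) x) atTop (𝓝 (ψ' x))) :
    ∫ x in I, (g.1 0 : L2 I) x * ψ' x = -∫ x in I, (g.1 1 : L2 I) x * ψ x := by
  have key : ∀ (u : L2 I) (k : ℕ) (χ : ℝ → ℝ),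
      (∀ᶠ n in atTop, ∀ x, |iteratedDeriv k (φ n) x| ≤ b x) →
      (∀ᵐ x ∂volume.restrict I, Tendsto (fun n => iteratedDeriv k (φ n) x) atTop (𝓝 (χ x))) →
      Tendsto (fun n => ∫ x in I, u x * iteratedDeriv k (φ n) x) atTop
        (𝓝 (∫ x in I, u x * χ x)) := by
    intro u k χ hk hχ
    refine tendsto_integral_filter_of_dominated_convergence (fun x => |u x| * b x) ?_ ?_ ?_ ?_
    · filter_upwards [hφ] with n hn
      exact (integrable_mul_test hn k u).aestronglyMeasurable
    · filter_upwards [hk] with n hn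
      refine Eventually.of_forall fun x => ?_
      rw [Real.norm_eq_abs, abs_mul]
      exact mul_le_mul_of_nonneg_left (hn x) (abs_nonneg _)
    · exact (Lp.memLp u).abs.integrable_mul hb
    · filter_upwards [hχ] with x hx
      exact hx.const_mul _
  refine tendsto_nhds_unique (key (g.1 0) 1 ψ' (by simpa using h1) (by simpa using hψ')) ?_
  refine (key (g.1 1) 0 ψ (by simpa using h0) (by simpa using hψ)).neg.congr' ?_
  filter_upwards [hφ] with n hn
  have := g.2 1 (φ n) hn
  simpa using this.symm

lemma truncPow_one (y : ℝ) : truncPow 1 y = max y 0 := by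
  rw [truncPow_succ 0 y, zero_add, pow_one]

lemma deriv_eq_zero_of_zero_outside {K : Set ℝ} (hK : IsClosed K) {φ : ℝ → ℝ}
    (h : ∀ x, x ∉ K → φ x = 0) : ∀ x, x ∉ K → deriv φ x = 0 := by
  intro x hx
  have : φ =ᶠ[𝓝 x] fun _ => 0 := by
    filter_upwards [hK.isOpen_compl.mem_nhds hx] with y hy using h y hy
  rw [this.deriv_eq, deriv_const]

/-- The primitive of `step a t` corrected by a multiple of the cutoff function `M` so as to have
compact support. -/
noncomputable def stepPrim (M : ℝ → ℝ) (a t x : ℝ) : ℝ :=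
  -(truncPow 1 (t - x) - truncPow 1 (a - x)) + (t - a) * M x

/-- On the left the two ramps differ by exactly `t - a`, which the cutoff term with `M = 1` cancels;
on the right every term vanishes. -/
lemma stepPrim_eq_zero {M : ℝ → ℝ} {a t δ x : ℝ} (hδ : 0 < δ) (hM1 : ∀ x, x ≤ a - δ → M x = 1)
    (hM0 : ∀ x, a + δ ≤ x → M x = 0) (ht : |t - a| < δ) (hx : δ ≤ |x - a|) :
    stepPrim M a t x = 0 := by
  rw [abs_lt] at ht
  rw [stepPrim, truncPow_one, truncPow_one]
  rcases le_abs'.1 hx with h | h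
  · rw [hM1 x (by linarith), max_eq_left (by linarith), max_eq_left (by linarith)]
    ring
  · rw [hM0 x (by linarith), max_eq_right (by linarith), max_eq_right (by linarith)]
    ring

/-- Integration by parts against `step a t` for functions in `H¹(I)`. -/
lemma integral_mul_step {I : Set ℝ} {a δ : ℝ} (hδ : 0 < δ) (hI : Icc (a - δ) (a + δ) ⊆ I)
    {M : ℝ → ℝ} (hM : ContDiff ℝ ∞ M) (hM1 : ∀ x, x ≤ a - δ → M x = 1)
    (hM0 : ∀ x, a + δ ≤ x → M x = 0) {t : ℝ} (ht : |t - a| < δ) (g : Sob 1 I) :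
    ∫ x in I, (g.1 0 : L2 I) x * (step a t x + (t - a) * deriv M x) =
      -∫ x in I, (g.1 1 : L2 I) x * stepPrim M a t x := by
  obtain ⟨ρ, hρ, hρ0, hρ1, hρb, hρd0, hρd1, C, hC⟩ := exists_smooth_ramp
  have hρd : ∀ y, HasDerivAt ρ (deriv ρ y) y := fun y =>
    (hρ.differentiable (by simp) y).hasDerivAt
  set K := Icc (a - δ) (a + δ) with hK
  have hKmem : ∀ x, x ∉ K → δ < |x - a| := fun x hx => by
    by_contra! h
    rw [abs_le] at h
    exact hx ⟨by linarith, by linarith⟩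
  obtain ⟨C₀, hC₀⟩ := (isCompact_Icc (a := a - δ) (b := a + δ)).exists_bound_of_continuousOn
    hM.continuous.continuousOn
  obtain ⟨C₁, hC₁⟩ := (isCompact_Icc (a := a - δ) (b := a + δ)).exists_bound_of_continuousOn
    (hM.continuous_deriv (by simp)).continuousOn
  let N : ℕ → ℝ := fun n => (n : ℝ) + 1
  have hN : ∀ n, 0 < N n := fun n => by positivity
  have hNt : Tendsto N atTop atTop := tendsto_natCast_atTop_atTop.atTop_add tendsto_const_nhds
  have hlarge : ∀ y, 0 < y → ∀ᶠ n in atTop, 1 < N n * y := fun y hy =>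
    (hNt.atTop_mul_const hy).eventually_gt_atTop 1
  -- `stepPrim M a t` with each positive part replaced by its smooth rescaled ramp.
  let φ : ℕ → ℝ → ℝ := fun n x =>
    -(ρ (N n * (t - x)) / N n - ρ (N n * (a - x)) / N n) + (t - a) * M x
  have hφd : ∀ n x, deriv (φ n) x =
      (deriv ρ (N n * (t - x)) - deriv ρ (N n * (a - x))) + (t - a) * deriv M x := by
    intro n x
    have h1 : ∀ b : ℝ, HasDerivAt (fun x => ρ (N n * (b - x)) / N n)
        (-deriv ρ (N n * (b - x))) x := by
      intro b
      have h2 : HasDerivAt (fun x => N n * (b - x)) (N n * -1) x :=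
        ((hasDerivAt_id x).const_sub b).const_mul (N n)
      refine (((hρd (N n * (b - x))).comp x h2).div_const (N n)).congr_deriv ?_
      field_simp [(hN n).ne']
    refine (((h1 t).sub (h1 a)).neg.add
      ((hM.differentiable (by simp) x).hasDerivAt.const_mul (t - a))).deriv.trans ?_
    ring
  have hsm : ∀ n, ContDiff ℝ ∞ (φ n) := by
    intro n
    have h1 : ∀ b : ℝ, ContDiff ℝ ∞ fun x => ρ (N n * (b - x)) / N n := fun b =>
      (hρ.comp (contDiff_const.mul (contDiff_const.sub contDiff_id))).div_const _
    exact ((h1 t).sub (h1 a)).neg.add (contDiff_const.mul hM)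
  have hzero : ∀ᶠ n in atTop, ∀ x, x ∉ K → φ n x = 0 := by
    -- To the left of `K` both `t - x` and `a - x` exceed the margin `δ - |t - a|`, so for large `n`
    -- both ramps have reached their linear regime and the cancellation is exact.
    filter_upwards [hlarge (δ - |t - a|) (by linarith)] with n hn x hx
    have htl := abs_lt.1 ht
    have hta := abs_le.1 (le_refl |t - a|)
    simp only [φ]
    rcases lt_abs.1 (hKmem x hx) with h | h
    · rw [hρ0 _ (mul_nonpos_of_nonneg_of_nonpos (hN n).le (by linarith)),
        hρ0 _ (mul_nonpos_of_nonneg_of_nonpos (hN n).le (by linarith)), hM0 x (by linarith)]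
      ring
    · have h1 : 1 ≤ N n * (t - x) :=
        hn.le.trans (mul_le_mul_of_nonneg_left (by linarith) (hN n).le)
      have h2 : 1 ≤ N n * (a - x) :=
        hn.le.trans (mul_le_mul_of_nonneg_left (by linarith [abs_nonneg (t - a)]) (hN n).le)
      rw [hρ1 _ h1, hρ1 _ h2, hM1 x (by linarith), mul_div_cancel_left₀ _ (hN n).ne',
        mul_div_cancel_left₀ _ (hN n).ne']
      ring
  have hρN : ∀ n y, |ρ (N n * y) / N n| ≤ |y| := by
    intro n y
    rw [abs_div, abs_of_pos (hN n), div_le_iff₀ (hN n)]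
    refine (hρb _).trans_eq ?_
    rw [abs_mul, abs_of_pos (hN n), mul_comm]
  -- The sum of the bounds for `φ n` and for its derivative on `K`, so that one dominating function
  -- serves both.
  set D := (2 * δ + δ + δ * C₀) + (C + C + δ * C₁) with hD
  have hC0 : 0 ≤ C := (abs_nonneg _).trans (hC 0)
  have haK : a ∈ K := ⟨by linarith, by linarith⟩
  have hC₀0 : 0 ≤ C₀ := (norm_nonneg _).trans (hC₀ a haK)
  have hC₁0 : 0 ≤ C₁ := (norm_nonneg _).trans (hC₁ a haK)
  refine integral_mul_of_tendsto g (φ := φ) (b := K.indicator fun _ => D) ?_ ?_ ?_ ?_ ?_ ?_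
  · filter_upwards [hzero] with n hn
    refine ⟨hsm n, hasCompactSupport_of_zero isCompact_Icc hn,
      (closure_minimal (fun x hx => ?_) isClosed_Icc).trans hI⟩
    by_contra hx'
    exact hx (hn x hx')
  · exact memLp_indicator_const 2 measurableSet_Icc D (Or.inr
      ((Measure.restrict_apply_le _ _).trans_lt measure_Icc_lt_top).ne)
  · filter_upwards [hzero] with n hn x
    by_cases hx : x ∈ K
    · rw [indicator_of_mem hx]
      have hxa : |a - x| ≤ δ := abs_le.2 ⟨by linarith [hx.2], by linarith [hx.1]⟩
      have hxt : |t - x| ≤ 2 * δ := by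
        have := abs_add_le (t - a) (a - x)
        rw [sub_add_sub_cancel] at this
        linarith
      have h1 : |φ n x| ≤ (|t - x| + |a - x|) + δ * C₀ := by
        refine (abs_add_le _ _).trans (add_le_add ?_ ?_)
        · rw [abs_neg]
          exact (abs_sub _ _).trans (add_le_add (hρN n _) (hρN n _))
        · rw [abs_mul]
          exact mul_le_mul ht.le (hC₀ x hx) (abs_nonneg _) hδ.le
      have : 0 ≤ δ * C₁ := mul_nonneg hδ.le hC₁0
      linarith
    · rw [indicator_of_notMem hx, hn x hx, abs_zero]
  · filter_upwards [hzero] with n hn x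
    by_cases hx : x ∈ K
    · rw [indicator_of_mem hx, hφd]
      have h1 : |deriv ρ (N n * (t - x)) - deriv ρ (N n * (a - x)) + (t - a) * deriv M x| ≤
          (C + C) + δ * C₁ := by
        refine (abs_add_le _ _).trans (add_le_add ?_ ?_)
        · exact (abs_sub _ _).trans (add_le_add (hC _) (hC _))
        · rw [abs_mul]
          exact mul_le_mul ht.le (hC₁ x hx) (abs_nonneg _) hδ.le
      have : 0 ≤ δ * C₀ := mul_nonneg hδ.le hC₀0
      linarith
    · rw [indicator_of_notMem hx, deriv_eq_zero_of_zero_outside isClosed_Icc hn x hx, abs_zero]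
  · refine Eventually.of_forall fun x => ?_
    have h1 : ∀ y : ℝ, Tendsto (fun n => ρ (N n * y) / N n) atTop (𝓝 (truncPow 1 y)) := by
      intro y
      rw [truncPow_one]
      refine tendsto_const_nhds.congr' ?_
      rcases le_or_gt y 0 with hy | hy
      · refine Eventually.of_forall fun n => ?_
        beta_reduce
        rw [max_eq_right hy, hρ0 _ (mul_nonpos_of_nonneg_of_nonpos (hN n).le hy), zero_div]
      · filter_upwards [hlarge y hy] with n hn
        rw [max_eq_left hy.le, hρ1 _ hn.le, mul_div_cancel_left₀ _ (hN n).ne']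
    exact ((h1 (t - x)).sub (h1 (a - x))).neg.add tendsto_const_nhds
  · have h1 : ∀ y : ℝ, y ≠ 0 →
        Tendsto (fun n => deriv ρ (N n * y)) atTop (𝓝 (truncPow 0 y)) := by
      intro y hy0
      refine tendsto_const_nhds.congr' ?_
      rcases hy0.lt_or_gt with hy | hy
      · refine Eventually.of_forall fun n => ?_
        beta_reduce
        rw [truncPow_of_nonpos 0 hy.le, hρd0 _ (mul_neg_of_pos_of_neg (hN n) hy)]
      · filter_upwards [hlarge y hy] with n hn
        rw [truncPow_zero_of_pos hy, hρd1 _ hn]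
    filter_upwards [ae_restrict_of_ae (Measure.ae_ne volume t),
      ae_restrict_of_ae (Measure.ae_ne volume a)] with x hxt hxa
    simp only [hφd]
    exact ((h1 _ (sub_ne_zero.2 hxt.symm)).sub (h1 _ (sub_ne_zero.2 hxa.symm))).add
      tendsto_const_nhds

/-! ### Calculus of `dualSob` -/

lemma dualSob_add {I : Set ℝ} {u v : ℝ → ℝ} (hu : MemLp u 2 (volume.restrict I))
    (hv : MemLp v 2 (volume.restrict I)) :
    dualSob I (fun x => u x + v x) = dualSob I u + dualSob I v := by
  have huv : MemLp (fun x => u x + v x) 2 (volume.restrict I) := hu.add hv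
  ext g
  have i1 : Integrable (fun x => (g.1 0 : L2 I) x * u x) (volume.restrict I) :=
    (Lp.memLp (g.1 0 : L2 I)).integrable_mul hu
  have i2 : Integrable (fun x => (g.1 0 : L2 I) x * v x) (volume.restrict I) :=
    (Lp.memLp (g.1 0 : L2 I)).integrable_mul hv
  rw [add_apply, dualSob_apply I hu, dualSob_apply I hv, dualSob_apply I huv,
    ← integral_add i1 i2]
  exact integral_congr_ae (Eventually.of_forall fun x => mul_add _ _ _)

/-- Additivity over adjacent signed intervals; it isolates the dependence on each knot. -/
lemma dualSob_step_add (I : Set ℝ) (a b c : ℝ) :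
    dualSob I (step a b) + dualSob I (step b c) = dualSob I (step a c) := by
  rw [← dualSob_add (memLp_step a b I) (memLp_step b c I)]
  congr 1
  funext x
  simp only [step]
  ring

/-- For `t` near `a` the step lives in a neighbourhood of `a` disjoint from `I`, so the functional
is locally zero. -/
lemma differentiableAt_dualSob_step_of_notMem {I : Set ℝ} (hI : IsOpen I) {a : ℝ}
    (ha : a ∉ closure I) : DifferentiableAt ℝ (fun t => dualSob I (step a t)) a := by
  obtain ⟨δ, hδ, hball⟩ := Metric.isOpen_iff.1 isClosed_closure.isOpen_compl a ha
  refine (differentiableAt_const (0 : Sob 1 I →L[ℝ] ℝ)).congr_of_eventuallyEq ?_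
  filter_upwards [Metric.ball_mem_nhds a hδ] with t ht
  ext g
  rw [dualSob_apply I (memLp_step a t I)]
  refine integral_eq_zero_of_ae ?_
  filter_upwards [ae_restrict_mem hI.measurableSet] with x hx
  have hxa : δ ≤ |x - a| := by
    by_contra! h
    exact hball h (subset_closure hx)
  rw [step_eq_zero ht hxa, mul_zero]
  rfl

section

variable {V L : Type*} [NormedAddCommGroup V] [NormedSpace ℝ V] [NormedAddCommGroup L]

lemma differentiableAt_add_sub {A B : ℝ → V} {c : V} {τ : Fin 2 → ℝ}
    (hA : DifferentiableAt ℝ A (τ 1)) (hB : DifferentiableAt ℝ B (τ 0)) :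
    DifferentiableAt ℝ (fun σ : Fin 2 → ℝ => c + A (σ 1) - B (σ 0)) τ :=
  ((differentiableAt_const c).fun_add (hA.comp τ (differentiableAt_apply 1 τ))).fun_sub
    (hB.comp τ (differentiableAt_apply 0 τ))

lemma differentiableAt_dual_comp {X : Type*} [NormedAddCommGroup X] [NormedSpace ℝ X]
    [NormedSpace ℝ L] {F : X → L →L[ℝ] ℝ} {x : X} (h : DifferentiableAt ℝ F x) (P : V →L[ℝ] L) :
    DifferentiableAt ℝ (fun y => (F y).comp P) x :=
  h.clm_comp (differentiableAt_const P)

lemma differentiableAt_inner_comp [InnerProductSpace ℝ L] (P Q : V →L[ℝ] L) (w : L) {Ψ : ℝ → L}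
    {a : ℝ} (h : DifferentiableAt ℝ Ψ a) : DifferentiableAt ℝ
      (fun t => -((t - a) • (innerSL ℝ w).comp P) - (innerSL ℝ (Ψ t)).comp Q) a := by
  have h1 : DifferentiableAt ℝ (fun t => innerSL ℝ (Ψ t)) a :=
    (innerSL ℝ (E := L)).differentiableAt.comp a h
  have h2 : DifferentiableAt ℝ (fun t => (t - a) • (innerSL ℝ w).comp P) a := by fun_prop
  exact h2.fun_neg.fun_sub (differentiableAt_dual_comp h1 Q)

end

/-- The step is not differentiable in `t` in `L²`, but its primitive is. After integration by parts
the functional is `-(t - a)⟨M', g⟩ - ⟨Ψ t, g'⟩`, with `Ψ` differentiable into `L²(I)`. -/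
lemma differentiableAt_dualSob_step_of_mem {I : Set ℝ} (hI : IsOpen I) {a : ℝ}
    (ha : a ∈ I) : DifferentiableAt ℝ (fun t => dualSob I (step a t)) a := by
  obtain ⟨δ, hδ, hball⟩ := Metric.nhds_basis_closedBall.mem_iff.1 (hI.mem_nhds ha)
  rw [Real.closedBall_eq_Icc] at hball
  -- A smooth descent from `1` to `0` across `[a - δ, a + δ]`; its derivative is supported there,
  -- hence square integrable.
  let M : ℝ → ℝ := fun x => Real.smoothTransition ((a + δ - x) / (2 * δ))
  have hM : ContDiff ℝ ∞ M := Real.smoothTransition.contDiff.comp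
    ((contDiff_const.sub contDiff_id).div_const _)
  have hM1 : ∀ x, x ≤ a - δ → M x = 1 := fun x hx =>
    Real.smoothTransition.one_of_one_le (by rw [le_div_iff₀ (by linarith)]; linarith)
  have hM0 : ∀ x, a + δ ≤ x → M x = 0 := fun x hx =>
    Real.smoothTransition.zero_of_nonpos (div_nonpos_of_nonpos_of_nonneg (by linarith)
      (by linarith))
  have hMd : ∀ x, x ∉ Icc (a - δ) (a + δ) → deriv M x = 0 := by
    intro x hx
    have : ∃ c : ℝ, M =ᶠ[𝓝 x] fun _ => c := by
      rcases lt_or_ge x (a - δ) with h | h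
      · exact ⟨1, by filter_upwards [Iio_mem_nhds h] with y hy using hM1 y (le_of_lt hy)⟩
      · have h' : a + δ < x := not_le.1 fun h' => hx ⟨h, h'⟩
        exact ⟨0, by filter_upwards [Ioi_mem_nhds h'] with y hy using hM0 y (le_of_lt hy)⟩
    obtain ⟨c, hc⟩ := this
    rw [hc.deriv_eq, deriv_const]
  have hMdm : MemLp (deriv M) 2 (volume.restrict I) :=
    memLp_of_continuous isCompact_Icc (hM.continuous_deriv (by simp)) hMd I
  -- `[-R, R]` contains `[a - δ, a + δ]`, outside which `stepPrim` vanishes, so cutting off its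
  -- separate terms does not alter their sum.
  set R := |a| + δ with hR
  have hMm : MemLp ((Icc (-R) R).indicator M) 2 (volume.restrict I) :=
    memLp_indicator_of_bound hM.continuous.measurable (C := 1) (fun x _ => by
      rw [abs_of_nonneg (Real.smoothTransition.nonneg _)]
      exact Real.smoothTransition.le_one _) I
  let Ψ : ℝ → L2 I := fun t =>
    -(truncL2 I R 1 t - truncL2 I R 1 a) + (t - a) • hMm.toLp
  have hΨ : Differentiable ℝ Ψ := by
    have := differentiable_truncL2 I R le_rfl
    fun_prop
  have hΨae : ∀ t, |t - a| < δ → Ψ t =ᵐ[volume.restrict I] stepPrim M a t := by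
    intro t ht
    filter_upwards [Lp.coeFn_add (-(truncL2 I R 1 t - truncL2 I R 1 a)) ((t - a) • hMm.toLp),
      Lp.coeFn_neg (truncL2 I R 1 t - truncL2 I R 1 a),
      Lp.coeFn_sub (truncL2 I R 1 t) (truncL2 I R 1 a), Lp.coeFn_smul (t - a) hMm.toLp,
      hMm.coeFn_toLp, truncL2_ae I R 1 t, truncL2_ae I R 1 a] with x e1 e2 e3 e4 e5 e6 e7
    rw [e1, Pi.add_apply, e2, Pi.neg_apply, e3, Pi.sub_apply, e4, Pi.smul_apply, e5, e6, e7]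
    by_cases hx : x ∈ Icc (-R) R
    · simp only [indicator_of_mem hx, stepPrim, smul_eq_mul]
    · simp only [indicator_of_notMem hx]
      rw [stepPrim_eq_zero hδ hM1 hM0 ht]
      · simp
      · by_contra! h
        refine hx (abs_le.1 ?_)
        have : |x| ≤ |x - a| + |a| := by simpa using abs_add_le (x - a) a
        linarith
  let P : Fin 2 → Sob 1 I →L[ℝ] L2 I := fun k =>
    (PiLp.proj 2 (fun _ : Fin (1 + 1) => L2 I) k).comp (Sob 1 I).subtypeL
  have hdiff : DifferentiableAt ℝ (fun t => -((t - a) • (innerSL ℝ hMdm.toLp).comp (P 0)) -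
      (innerSL ℝ (Ψ t)).comp (P 1)) a :=
    differentiableAt_inner_comp (V := Sob 1 I) (P 0) (P 1) hMdm.toLp (hΨ a)
  refine hdiff.congr_of_eventuallyEq ?_
  filter_upwards [Metric.ball_mem_nhds a hδ] with t ht
  have htδ : |t - a| < δ := ht
  ext g
  have h0 := integral_mul_step hδ hball hM hM1 hM0 htδ g
  have i1 : Integrable (fun x => (g.1 0 : L2 I) x * step a t x) (volume.restrict I) :=
    (Lp.memLp (g.1 0 : L2 I)).integrable_mul (memLp_step a t I)
  have i2 : Integrable (fun x => (g.1 0 : L2 I) x * deriv M x) (volume.restrict I) :=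
    (Lp.memLp (g.1 0 : L2 I)).integrable_mul hMdm
  have e1 : ∫ x in I, (g.1 0 : L2 I) x * (step a t x + (t - a) * deriv M x) =
      (∫ x in I, (g.1 0 : L2 I) x * step a t x) +
        (t - a) * ∫ x in I, (g.1 0 : L2 I) x * deriv M x := by
    rw [← integral_const_mul, ← integral_add i1 (i2.const_mul _)]
    exact integral_congr_ae (Eventually.of_forall fun x => by simp only []; ring)
  have e2 : ∫ x in I, (g.1 1 : L2 I) x * stepPrim M a t x = inner ℝ (Ψ t) (g.1 1 : L2 I) := by
    rw [L2.inner_def]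
    refine integral_congr_ae ?_
    filter_upwards [hΨae t htδ] with x hx
    simp [hx]
  rw [e1, e2, integral_mul_eq_inner hMdm] at h0
  rw [dualSob_apply I (memLp_step a t I)]
  change _ = -((t - a) * inner ℝ hMdm.toLp (g.1 0 : L2 I)) - inner ℝ (Ψ t) (g.1 1 : L2 I)
  linarith

lemma differentiableAt_dualSob_step {I : Set ℝ} (hI : IsOpen I) {a : ℝ} (ha : a ∉ frontier I) :
    DifferentiableAt ℝ (fun t => dualSob I (step a t)) a := by
  by_cases h : a ∈ I
  · exact differentiableAt_dualSob_step_of_mem hI h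
  · refine differentiableAt_dualSob_step_of_notMem hI fun h' => ha ?_
    rw [frontier, hI.interior_eq]
    exact ⟨h', h⟩

lemma differentiableAt_dualSob_bspline {I : Set ℝ} (hI : IsOpen I) {τ : Fin 2 → ℝ}
    (hτ : ∀ j, τ j ∉ frontier I) :
    DifferentiableAt ℝ (fun σ => dualSob I (bspline 0 σ)) τ := by
  have h : (fun σ => dualSob I (bspline 0 σ)) = fun σ : Fin 2 → ℝ =>
      dualSob I (step (τ 0) (τ 1)) + dualSob I (step (τ 1) (σ 1)) -
        dualSob I (step (τ 0) (σ 0)) := by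
    funext σ
    have h1 := dualSob_step_add I (τ 0) (σ 0) (σ 1)
    rw [bspline_zero_eq_step, dualSob_step_add, ← h1, add_sub_cancel_left]
  rw [h]
  exact differentiableAt_add_sub (V := Sob 1 I →L[ℝ] ℝ)
    (A := fun t => dualSob I (step (τ 1) t)) (B := fun t => dualSob I (step (τ 0) t))
    (differentiableAt_dualSob_step hI (hτ 1)) (differentiableAt_dualSob_step hI (hτ 0))

lemma memLp_bspline_zero (τ : Fin 2 → ℝ) (J : Set ℝ) :
    MemLp (bspline 0 τ) 2 (volume.restrict J) := by
  rw [bspline_zero_eq_step]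
  exact memLp_step _ _ J

/-! ### Extension by zero of functions in `H_0^s(I)` -/

lemma memLp_indicator {I : Set ℝ} (hI : IsOpen I) (u : L2 I) :
    MemLp (I.indicator u) 2 (volume.restrict univ) := by
  rw [memLp_indicator_iff_restrict hI.measurableSet, Measure.restrict_univ]
  exact Lp.memLp u

/-- Extension by zero `L²(I) → L²(ℝ)`. -/
noncomputable def zeroExt {I : Set ℝ} (hI : IsOpen I) : L2 I →L[ℝ] L2 univ :=
  LinearMap.mkContinuous
    { toFun := fun u => (memLp_indicator hI u).toLp
      map_add' := fun u v => by
        refine Lp.ext ?_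
        have h := ae_restrict_of_ae (s := univ) ((ae_restrict_iff' hI.measurableSet).1 (Lp.coeFn_add u v))
        filter_upwards [h, (memLp_indicator hI u).coeFn_toLp, (memLp_indicator hI v).coeFn_toLp,
          (memLp_indicator hI (u + v)).coeFn_toLp,
          Lp.coeFn_add (memLp_indicator hI u).toLp (memLp_indicator hI v).toLp]
          with x h1 h2 h3 h4 h5
        rw [h4, h5, Pi.add_apply, h2, h3]
        by_cases hx : x ∈ I
        · simp only [indicator_of_mem hx]
          rw [h1 hx, Pi.add_apply]
        · simp only [indicator_of_notMem hx, add_zero]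
      map_smul' := fun c u => by
        refine Lp.ext ?_
        have h := ae_restrict_of_ae (s := univ) ((ae_restrict_iff' hI.measurableSet).1 (Lp.coeFn_smul c u))
        filter_upwards [h, (memLp_indicator hI u).coeFn_toLp,
          (memLp_indicator hI (c • u)).coeFn_toLp,
          Lp.coeFn_smul c (memLp_indicator hI u).toLp] with x h1 h2 h3 h4
        rw [h3, RingHom.id_apply, h4, Pi.smul_apply, h2]
        by_cases hx : x ∈ I
        · simp only [indicator_of_mem hx]
          rw [h1 hx, Pi.smul_apply]
        · simp only [indicator_of_notMem hx, smul_zero] }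
    1 (fun u => by
      rw [one_mul]
      refine (Lp.norm_toLp _ (memLp_indicator hI u)).trans_le ?_
      rw [eLpNorm_indicator_eq_eLpNorm_restrict hI.measurableSet, Measure.restrict_univ]
      exact le_rfl)

lemma zeroExt_ae {I : Set ℝ} (hI : IsOpen I) (u : L2 I) :
    zeroExt hI u =ᵐ[volume.restrict univ] I.indicator u :=
  (memLp_indicator hI u).coeFn_toLp

/-- Extension by zero, applied to a function and its weak derivatives. -/
noncomputable def zeroExtPi (s : ℕ) {I : Set ℝ} (hI : IsOpen I) :
    (PiLp 2 fun _ : Fin (s + 1) => L2 I) →L[ℝ] PiLp 2 fun _ : Fin (s + 1) => L2 univ where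
  toFun U := WithLp.toLp 2 fun k => zeroExt hI (U k)
  map_add' U V := PiLp.ext fun k => map_add (zeroExt hI) (U k) (V k)
  map_smul' c U := PiLp.ext fun k => map_smul (zeroExt hI) c (U k)
  cont := (PiLp.continuous_toLp 2 _).comp (continuous_pi fun k =>
    (zeroExt hI).continuous.comp (PiLp.continuous_apply 2 _ k))

/-- The `U` whose extension by zero is weakly differentiable form a closed subspace containing the
test functions, hence also their closure. -/
lemma zeroExtPi_mem {s : ℕ} {I : Set ℝ} (hI : IsOpen I) {U : Sob s I} (hU : U ∈ SobZero s I) :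
    zeroExtPi s hI U.1 ∈ Sob s univ := by
  let T : Submodule ℝ (Sob s I) :=
    (Sob s univ).comap ((zeroExtPi s hI).comp (Sob s I).subtypeL).toLinearMap
  have hT : IsClosed (T : Set (Sob s I)) :=
    (isClosed_Sob s univ).preimage ((zeroExtPi s hI).comp (Sob s I).subtypeL).continuous
  refine (Submodule.topologicalClosure_minimal _ (Submodule.span_le.2 ?_) hT : _ ≤ T) hU
  rintro V ⟨φ, hφ, hV⟩
  have hd : ∀ k < s, ∀ x, HasDerivAt (iteratedDeriv k φ) (iteratedDeriv (k + 1) φ x) x := by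
    intro k _ x
    rw [iteratedDeriv_succ]
    exact ((hφ.1.differentiable_iteratedDeriv k (by exact_mod_cast WithTop.coe_lt_top _)) x).hasDerivAt
  have hc : ∀ k ≤ s, Continuous (iteratedDeriv k φ) := fun k _ =>
    hφ.1.continuous_iteratedDeriv k (by exact_mod_cast le_top)
  have hVk : ∀ k : Fin (s + 1), (V.1 k : L2 I) =ᵐ[volume.restrict I] iteratedDeriv k φ := by
    intro k
    have h1 := isWeakDeriv_of_hasDerivAt I hd hc k (by omega)
    rw [iteratedDeriv_zero] at h1
    have h2 := h1.congr_ae hV.symm (hφ.memLp (J := I) k).coeFn_toLp.symm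
    have h3 := (V.2 k).unique hI h2
    rw [h3]
    exact (hφ.memLp k).coeFn_toLp
  have hZ : ∀ k : Fin (s + 1), (zeroExt hI (V.1 k) : L2 univ) =ᵐ[volume.restrict univ]
      iteratedDeriv k φ := by
    intro k
    have h := ae_restrict_of_ae (s := univ) ((ae_restrict_iff' hI.measurableSet).1 (hVk k))
    filter_upwards [h, zeroExt_ae hI (V.1 k)] with x h1 h2
    rw [h2]
    by_cases hx : x ∈ I
    · rw [indicator_of_mem hx, h1 hx]
    · rw [indicator_of_notMem hx]
      by_contra h'
      exact hx (hφ.support_iteratedDeriv_subset k (Ne.symm h'))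
  intro k
  exact (isWeakDeriv_of_hasDerivAt univ hd hc k (by omega)).congr_ae (hZ 0).symm (hZ k).symm

/-- Extension by zero `H_0^s(I) → H^s(ℝ)`. -/
noncomputable def zeroExtSob (s : ℕ) {I : Set ℝ} (hI : IsOpen I) : SobZero s I →L[ℝ] Sob s univ :=
  ((zeroExtPi s hI).comp ((Sob s I).subtypeL.comp (SobZero s I).subtypeL)).codRestrict
    (Sob s univ) fun U => zeroExtPi_mem hI U.2

/-- Transfers the problem to the whole line, whose frontier is empty; this is why no condition on
the knots is needed for `H_0^1(I)`. -/
lemma dualSobZero_eq {I : Set ℝ} (hI : IsOpen I) {u : ℝ → ℝ}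
    (hu : MemLp u 2 (volume.restrict univ)) :
    dualSobZero I u = (dualSob univ u).comp (zeroExtSob 1 hI) := by
  have huI : MemLp u 2 (volume.restrict I) :=
    hu.mono_measure (Measure.restrict_mono (subset_univ I) le_rfl)
  ext g
  have h1 : dualSobZero I u g = dualSob I u g.1 := rfl
  have h2 : (dualSob univ u).comp (zeroExtSob 1 hI) g = dualSob univ u (zeroExtSob 1 hI g) := rfl
  have h3 : ((zeroExtSob 1 hI g).1 0 : L2 univ) = zeroExt hI (g.1.1 0) := rfl
  rw [h1, h2, dualSob_apply I huI, dualSob_apply univ hu, h3, ← integral_indicator hI.measurableSet]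
  refine setIntegral_univ.symm.trans (integral_congr_ae ?_)
  filter_upwards [zeroExt_ae hI (g.1.1 0)] with x hx
  rw [hx]
  by_cases hxI : x ∈ I
  · simp only [indicator_of_mem hxI]
  · simp only [indicator_of_notMem hxI, zero_mul]

lemma differentiableAt_dualSobZero_bspline {I : Set ℝ} (hI : IsOpen I) (τ : Fin 2 → ℝ) :
    DifferentiableAt ℝ (fun σ => dualSobZero I (bspline 0 σ)) τ := by
  simp only [fun σ : Fin 2 → ℝ => dualSobZero_eq hI (memLp_bspline_zero σ univ)]
  have h : DifferentiableAt ℝ (fun σ => dualSob univ (bspline 0 σ)) τ :=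
    differentiableAt_dualSob_bspline isOpen_univ (by simp)
  exact @differentiableAt_dual_comp (SobZero 1 I) (Sob 1 univ) _ (Submodule.normedSpace _) _
    _ _ _ _ _ _ h (zeroExtSob 1 hI)

/-- A differentiable family of functionals may be differentiated after evaluation. -/
lemma differentiableAt_family_apply {W : Type*} [NormedAddCommGroup W] [NormedSpace ℝ W]
    {n : ℕ} {D : (Fin n → ℝ) → W →L[ℝ] ℝ} {τ : Fin n → ℝ} (h : DifferentiableAt ℝ D τ) (w : W) :
    DifferentiableAt ℝ (fun σ => D σ w) τ ∧ ∀ i : Fin n,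
      DifferentiableAt ℝ (fun t : ℝ => D (Function.update τ i t)) (τ i) ∧
      HasDerivAt (fun t : ℝ => D (Function.update τ i t) w)
        (deriv (fun t : ℝ => D (Function.update τ i t)) (τ i) w) (τ i) := by
  refine ⟨h.clm_apply (differentiableAt_const w), fun i => ?_⟩
  have hi := differentiableAt_comp_update h i
  refine ⟨hi, ?_⟩
  simpa using hi.hasDerivAt.clm_apply (hasDerivAt_const (τ i) w)

end FreeKnot

/-! ### Differentiation of the pairings with respect to the knots -/

theorem mainTheorem7 (I : Set ℝ) (hI : IsOpen I) :
    -- `B_0(τ)` is square integrable, and for `p ≥ 1` the map `B_p` takes values in `H^{p-1}(ℝ)`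
    -- and has partial derivatives in the norm of that space
    (∀ τ ∈ FreeKnot.knots 2, MemLp (FreeKnot.bspline 0 τ) 2 volume) ∧
    (∀ p : ℕ, 1 ≤ p → ∀ τ ∈ FreeKnot.knots (p + 2),
      FreeKnot.MemSob (p - 1) univ (FreeKnot.bspline p τ) ∧
      ∀ i : Fin (p + 2), DifferentiableAt ℝ
        (fun t : ℝ => FreeKnot.bsplineSob p (Function.update τ i t)) (τ i)) ∧
    -- `p ≥ 1`, `f` in the dual of `H^{p-1}(I)`, all knot vectors
    (∀ p : ℕ, 1 ≤ p → ∀ f : FreeKnot.Sob (p - 1) I →L[ℝ] ℝ, ∀ τ ∈ FreeKnot.knots (p + 2),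
      DifferentiableAt ℝ
        (fun σ => f (FreeKnot.restr (p - 1) I (FreeKnot.bsplineSob p σ))) τ ∧
      ∀ i : Fin (p + 2), HasDerivAt
        (fun t : ℝ => f (FreeKnot.restr (p - 1) I
          (FreeKnot.bsplineSob p (Function.update τ i t))))
        (f (FreeKnot.restr (p - 1) I (FreeKnot.partialBspline p i τ))) (τ i)) ∧
    -- `p ≥ 1`, `f` in the dual of `H_0^{p-1}(I)`, all knot vectors with `(τ_1, τ_{p+2}) ⊆ I`
    (∀ p : ℕ, 1 ≤ p → ∀ f : FreeKnot.SobZero (p - 1) I →L[ℝ] ℝ, ∀ τ ∈ FreeKnot.knotsIn p I,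
      FreeKnot.restr (p - 1) I (FreeKnot.bsplineSob p τ) ∈ FreeKnot.SobZero (p - 1) I ∧
      (∀ i : Fin (p + 2),
        FreeKnot.restr (p - 1) I (FreeKnot.partialBspline p i τ) ∈
          FreeKnot.SobZero (p - 1) I) ∧
      DifferentiableWithinAt ℝ
        (fun σ => FreeKnot.pairZero f (FreeKnot.restr (p - 1) I (FreeKnot.bsplineSob p σ)))
        (FreeKnot.knotsIn p I) τ ∧
      ∀ i : Fin (p + 2), HasDerivWithinAt
        (fun t : ℝ => FreeKnot.pairZero f (FreeKnot.restr (p - 1) I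
          (FreeKnot.bsplineSob p (Function.update τ i t))))
        (FreeKnot.pairZero f (FreeKnot.restr (p - 1) I (FreeKnot.partialBspline p i τ)))
        {t : ℝ | Function.update τ i t ∈ FreeKnot.knotsIn p I} (τ i)) ∧
    -- `p = 0`, `f ∈ H¹(I)`, all knot vectors without knots on the boundary of `I`
    (∀ f : FreeKnot.Sob 1 I, ∀ τ ∈ FreeKnot.knots 2, (∀ j, τ j ∉ frontier I) →
      DifferentiableAt ℝ
        (fun σ => ∫ x in I, (f.1 0 : FreeKnot.L2 I) x * FreeKnot.bspline 0 σ x) τ ∧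
      ∀ i : Fin 2,
        DifferentiableAt ℝ
          (fun t : ℝ => FreeKnot.dualSob I (FreeKnot.bspline 0 (Function.update τ i t))) (τ i) ∧
        HasDerivAt
          (fun t : ℝ => ∫ x in I,
            (f.1 0 : FreeKnot.L2 I) x * FreeKnot.bspline 0 (Function.update τ i t) x)
          (FreeKnot.partialDual I i τ f) (τ i)) ∧
    -- `p = 0`, `f ∈ H_0^1(I)`, all knot vectors
    (∀ f : FreeKnot.SobZero 1 I, ∀ τ ∈ FreeKnot.knots 2,
      DifferentiableAt ℝ
        (fun σ => ∫ x in I, (f.1.1 0 : FreeKnot.L2 I) x * FreeKnot.bspline 0 σ x) τ ∧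
      ∀ i : Fin 2,
        DifferentiableAt ℝ
          (fun t : ℝ => FreeKnot.dualSobZero I (FreeKnot.bspline 0 (Function.update τ i t)))
          (τ i) ∧
        HasDerivAt
          (fun t : ℝ => ∫ x in I,
            (f.1.1 0 : FreeKnot.L2 I) x * FreeKnot.bspline 0 (Function.update τ i t) x)
          (FreeKnot.partialDualZero I i τ f) (τ i)) := by
  refine ⟨fun τ _ => ?_, fun p hp τ hτ => ?_, fun p hp f τ hτ => ?_, fun p hp f τ hτ => ?_,
    fun f τ _ hfr => ?_, fun f τ _ => ?_⟩
  · simpa using FreeKnot.memLp_bspline_zero τ univ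
  · exact ⟨(FreeKnot.bsplineSob_spec hp hτ).1,
      fun i => (FreeKnot.hasDerivAt_bsplineSob hp hτ i).differentiableAt⟩
  · refine ⟨?_, fun i => f.hasFDerivAt.comp_hasDerivAt (τ i)
      (FreeKnot.hasDerivAt_restr_bsplineSob hp I hτ i)⟩
    exact (f.comp (FreeKnot.restrCLM (p - 1) I)).differentiableAt.comp τ
      (FreeKnot.differentiableAt_bsplineSob hp hτ)
  · have hmem := fun σ (hσ : σ ∈ FreeKnot.knotsIn p I) =>
      FreeKnot.restr_bsplineSob_mem hp hI hσ
    have hpart := FreeKnot.restr_partialBspline_mem hp hI hτ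
    refine ⟨hmem τ hτ, hpart, ?_, fun i => ?_⟩
    -- `pairZero` has the default value `0` off `SobZero`, so it is replaced on `knotsIn` by
    -- `extendDual`, whose composition with the spline map is differentiable at `τ` without
    -- constraint.
    · have h : DifferentiableAt ℝ (fun σ => FreeKnot.extendDual f
          (FreeKnot.restr (p - 1) I (FreeKnot.bsplineSob p σ))) τ :=
        ((FreeKnot.extendDual f).comp (FreeKnot.restrCLM (p - 1) I)).differentiableAt.comp τ
          (FreeKnot.differentiableAt_bsplineSob hp hτ.1)
      exact h.differentiableWithinAt.congr (fun σ hσ => FreeKnot.pairZero_eq f (hmem σ hσ))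
        (FreeKnot.pairZero_eq f (hmem τ hτ))
    · rw [FreeKnot.pairZero_eq f (hpart i)]
      have h := (FreeKnot.extendDual f).hasFDerivAt.comp_hasDerivAt (τ i)
        (FreeKnot.hasDerivAt_restr_bsplineSob hp I hτ.1 i)
      refine h.hasDerivWithinAt.congr (fun t ht => FreeKnot.pairZero_eq f (hmem _ ht))
        (FreeKnot.pairZero_eq f (hmem _ ?_))
      rwa [Function.update_eq_self]
  · have h := FreeKnot.differentiableAt_family_apply
      (FreeKnot.differentiableAt_dualSob_bspline hI hfr) f
    simp only [FreeKnot.dualSob_apply I (FreeKnot.memLp_bspline_zero _ I)] at h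
    exact h
  · have h := @FreeKnot.differentiableAt_family_apply (FreeKnot.SobZero 1 I) _
      (Submodule.normedSpace _) _ _ _ (FreeKnot.differentiableAt_dualSobZero_bspline hI τ) f
    have e : ∀ σ : Fin 2 → ℝ, FreeKnot.dualSobZero I (FreeKnot.bspline 0 σ) f =
        ∫ x in I, (f.1.1 0 : FreeKnot.L2 I) x * FreeKnot.bspline 0 σ x := fun σ =>
      FreeKnot.dualSob_apply I (FreeKnot.memLp_bspline_zero σ I) f.1
    simp only [e] at h
    exact h
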